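/- Let $d\ge 1$, let $\Omega\subset\mathbb R^d$ be nonempty, open and bounded, and let $\Xi\subset\overline\Omega$ be nonempty and closed. Let $\Gamma=\mathcal C(\mathbb R_+;\overline\Omega)$ with the topology of uniform convergence on compact time intervals, and let $\ell:\mathbb R_+\times\overline\Omega\times\mathbb R^d\to\mathbb R_+$, $h:\mathbb R_+\times\overline\Omega\times\overline\Omega\times\mathbb R^d\times\mathbb R^d\to\mathbb R_+$, $\Psi:\mathbb R_+\to\mathbb R_+$ be given functions. For $\gamma\in\Gamma$ put $\tau(\gamma)=\inf\{t\ge 0:\gamma(t)\in\Xi\}$ (with $\inf\emptyset=+\infty$, and $\Psi(+\infty)=+\infty$), and for a Borel probability measure $Q$ on $\Gamma$ put $$F(\gamma,Q)=\int_0^{+\infty}\ell(t,\gamma(t),\dot\gamma(t))\,dt+\Psi(\tau(\gamma))+\int_\Gamma\int_0^{\tau(\gamma)\wedge\tau(\widetilde\gamma)}h(t,\gamma(t),\widetilde\gamma(t),\dot\gamma(t),\dot{\widetilde\gamma}(t))\,dt\,dQ(\widetilde\gamma),$$ with the convention $F(\gamma,Q)=+\infty$ if $\gamma$ is not absolutely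 continuous (on compact time intervals), if the set of curves that are not absolutely continuous has positive $Q$-measure, or if the inner integral of $h$ is not $Q$-integrable as a function of $\widetilde\gamma$. Let $m_0$ be a Borel probability measure on $\overline\Omega$. A Borel probability measure $Q$ on $\Gamma$ is an *equilibrium* with initial condition $m_0$ if the push-forward of $Q$ under $\gamma\mapsto\gamma(0)$ is $m_0$, $\int_\Gamma F(\gamma,Q)\,dQ(\gamma)<+\infty$, and $Q$-almost every $\gamma$ satisfies $$F(\gamma,Q)=\inf_{\omega\in\Gamma,\ \omega(0)=\gamma(0)}F(\omega,Q).$$ It is a *strong equilibrium* if the same holds with "$Q$-almost every $\gamma$" replaced by "every $\gamma\in\operatorname{supp}(Q)$". Assume the following. 1. $t\mapsto\ell(t,x,p)$ is measurable for all $(x,p)$; for almost every $t$, $(x,p)\mapsto\ell(t,x,p)$ is continuous and $p\mapsto\ell(t,x,p)$ is convex for every $x$; and there are $\alpha>0$, $\theta>1$ with $\ell(t,x,p)\ge\alpha|p|^\theta$ for all $(t,x,p)$. 2. $t\mapsto h(t,x,\widetilde x,p,\widetilde p)$ is measurable for all $(x,\widetilde x,p,\widetilde p)$; for almost every $t$,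 $h(t,\cdot)$ is continuous and $(p,\widetilde p)\mapsto h(t,x,\widetilde x,p,\widetilde p)$ is convex for all $(x,\widetilde x)$; $h(t,x,\widetilde x,p,\widetilde p)=h(t,\widetilde x,x,\widetilde p,p)$ for all arguments; and there are $C>0$, $\beta\in(0,\theta]$ with $h(t,x,\widetilde x,p,\widetilde p)\le C(|p|^\beta+|\widetilde p|^\beta)$ for all arguments. 3. $\Psi$ is lower semicontinuous and nondecreasing, and there are $a,b>0$ with $\Psi(t)\ge at-b$ for all $t\ge 0$. 4. There is $\kappa>0$ such that for every $x_0\in\overline\Omega$ there is an absolutely continuous $\gamma\in\Gamma$ with $\gamma(0)=x_0$ and $\int_0^{+\infty}\ell(t,\gamma(t),\dot\gamma(t))\,dt+\Psi(\tau(\gamma))\le\kappa$. 5. For every $x\in\overline\Omega$ and every sequence $x_n\to x$ in $\overline\Omega$, $\operatorname{dist}_{\mathrm{geo}}(x_n,x)\to 0$, where $\operatorname{dist}_{\mathrm{geo}}(x,y)\in[0,+\infty]$ is the infimum of the lengths of the continuous curves in $\overline\Omega$ from $x$ to $y$. 6. There is $\alpha^*>0$ with $\ell(t,x,p)\le\alpha^*|p|^\theta$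 for all $(t,x,p)$, with the same $\theta$ as in 1. Then a Borel probability measure $Q$ on $\Gamma$ is an equilibrium with initial condition $m_0$ if and only if it is a strong equilibrium with initial condition $m_0$. -/

import Mathlib

open MeasureTheory Set Filter Topology
open scoped NNReal ENNReal

/-- The data of the mean field game in `ℝ^d`: the domain `Ω`, the target set `Ξ`, the individual
running cost `ℓ(t, x, p)`, the pairwise interaction cost `h(t, x, x', p, p')` and the exit cost
`Ψ`. No property of the data is part of the structure. -/
structure MFG (d : ℕ) where
  Ω : Set (EuclideanSpace ℝ (Fin d))
  Ξ : Set (EuclideanSpace ℝ (Fin d))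
  ell : ℝ≥0 → closure Ω → EuclideanSpace ℝ (Fin d) → ℝ≥0
  h : ℝ≥0 → closure Ω → closure Ω → EuclideanSpace ℝ (Fin d) → EuclideanSpace ℝ (Fin d) → ℝ≥0
  Ψ : ℝ≥0 → ℝ≥0

namespace MFG

noncomputable section

variable {d : ℕ}

/-- The space `Γ` of continuous curves `ℝ₊ → closure Ω`. Its topology (the compact-open topology)
is that of uniform convergence on compact time intervals. -/
abbrev Curve (G : MFG d) : Type := C(ℝ≥0, closure G.Ω)

instance instMeasurableSpaceCurve (G : MFG d) : MeasurableSpace G.Curve := borel G.Curve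

instance instBorelSpaceCurve (G : MFG d) : BorelSpace G.Curve := ⟨rfl⟩

/-- Lebesgue measure on `ℝ₊ = [0, ∞)`. -/
def lebesgue : Measure ℝ≥0 := Measure.comap (fun t : ℝ≥0 => (t : ℝ)) volume

/-- A curve `γ : ℝ₊ → closure Ω`, seen as a map `ℝ → ℝ^d` (constant for negative times). -/
def extend (G : MFG d) (γ : G.Curve) : ℝ → EuclideanSpace ℝ (Fin d) :=
  fun t => (γ t.toNNReal : EuclideanSpace ℝ (Fin d))

/-- `γ` is absolutely continuous on each compact time interval `[0, T]`. -/
def IsAC (G : MFG d) (γ : G.Curve) : Prop :=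
  ∀ T : ℝ≥0, AbsolutelyContinuousOnInterval (G.extend γ) 0 T

/-- The velocity of `γ` at time `t`; only used for absolutely continuous curves, for which the
derivative exists at almost every time. -/
def velocity (G : MFG d) (γ : G.Curve) (t : ℝ≥0) : EuclideanSpace ℝ (Fin d) :=
  deriv (G.extend γ) t

/-- The first exit time `τ(γ) = inf {t | γ(t) ∈ Ξ}`, equal to `∞` if `γ` does not reach `Ξ`. -/
def exitTime (G : MFG d) (γ : G.Curve) : ℝ≥0∞ :=
  ⨅ (t : ℝ≥0) (_ : (γ t : EuclideanSpace ℝ (Fin d)) ∈ G.Ξ), (t : ℝ≥0∞)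

/-- The exit cost as a function on `[0, ∞]`, with the value `∞` at `∞`. -/
def exitCost (G : MFG d) (s : ℝ≥0∞) : ℝ≥0∞ :=
  if s = ∞ then ∞ else (G.Ψ s.toNNReal : ℝ≥0∞)

/-- The individual cost `∫_0^∞ ℓ(t, γ(t), γ'(t)) dt + Ψ(τ(γ))`. -/
def individualCost (G : MFG d) (γ : G.Curve) : ℝ≥0∞ :=
  (∫⁻ t, (G.ell t (γ t) (G.velocity γ t) : ℝ≥0∞) ∂lebesgue) + G.exitCost (G.exitTime γ)

/-- The interaction cost of two curves,
`∫_0^{τ(γ) ∧ τ(ω)} h(t, γ(t), ω(t), γ'(t), ω'(t)) dt`. -/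
def interaction (G : MFG d) (γ ω : G.Curve) : ℝ≥0∞ :=
  ∫⁻ t in {t : ℝ≥0 | (t : ℝ≥0∞) ≤ min (G.exitTime γ) (G.exitTime ω)},
    (G.h t (γ t) (ω t) (G.velocity γ t) (G.velocity ω t) : ℝ≥0∞) ∂lebesgue

open Classical in
/-- The cost `F(γ, Q)`. It is `∞` by convention if `γ` is not absolutely continuous, if `Q` does not
give full measure to the absolutely continuous curves, or if the interaction cost is not
`Q`-integrable in its second argument. -/
def cost (G : MFG d) (Q : Measure G.Curve) (γ : G.Curve) : ℝ≥0∞ :=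
  if G.IsAC γ ∧ (∀ᵐ ω ∂Q, G.IsAC ω) ∧
      (AEMeasurable (fun ω => G.interaction γ ω) Q ∧ ∫⁻ ω, G.interaction γ ω ∂Q < ∞) then
    G.individualCost γ + ∫⁻ ω, G.interaction γ ω ∂Q
  else ∞

/-- `γ` minimizes the cost `F(·, Q)` among all curves with the same starting point. -/
def IsOptimal (G : MFG d) (Q : Measure G.Curve) (γ : G.Curve) : Prop :=
  G.cost Q γ = ⨅ (ω : G.Curve) (_ : ω 0 = γ 0), G.cost Q ω

/-- Equilibrium with initial condition `m₀`. -/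
def IsEquilibrium (G : MFG d) (m₀ : Measure (closure G.Ω)) (Q : Measure G.Curve) : Prop :=
  Q.map (fun γ : G.Curve => γ 0) = m₀ ∧ ∫⁻ γ, G.cost Q γ ∂Q < ∞ ∧ ∀ᵐ γ ∂Q, G.IsOptimal Q γ

/-- Strong equilibrium with initial condition `m₀`. -/
def IsStrongEquilibrium (G : MFG d) (m₀ : Measure (closure G.Ω)) (Q : Measure G.Curve) : Prop :=
  Q.map (fun γ : G.Curve => γ 0) = m₀ ∧ ∫⁻ γ, G.cost Q γ ∂Q < ∞ ∧
    ∀ γ ∈ Q.support, G.IsOptimal Q γ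

/-- The geodesic distance in `closure Ω`: the infimum of the lengths of the paths in `closure Ω`
from `x` to `y` (`∞` if there is no path of finite length). -/
def geoDist (G : MFG d) (x y : closure G.Ω) : ℝ≥0∞ :=
  ⨅ c : Path x y, eVariationOn (fun s : unitInterval => c s) univ

end

end MFG

/-! A strong equilibrium is an equilibrium because `Q.support` has full measure. Conversely, optimal
curves have full measure at an equilibrium, so every neighbourhood of a point of the support
contains one. Since `Γ` is metrizable, it suffices that a limit `γ` of optimal curves `u n` is
optimal (`Regular.isOptimal_of_tendsto`).

Two estimates give this. The first is lower semicontinuity of the cost along sequences of bounded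
cost (`Regular.cost_le_of_tendsto`). The coercivity of `ell` bounds the kinetic energies, so the
limit is absolutely continuous and the velocities converge weakly. Convexity in the velocity then
yields Tonelli's theorem, the exit time and the exit cost are lower semicontinuous, and Fatou's
lemma handles the integral over `Q`.

The second is an upper bound (`Regular.exists_competitor`). Let `ω` start at `γ 0`. For large `n`
the point `u n 0` is joined to `γ 0` by a path of length less than `δ / 2`. Follow it at speed at
most one during time `δ / 2`, then run along `ω` at double speed until time `δ`, then follow `ω`
exactly. From time `δ` on there is no delay, so no regularity of the costs in `t` is needed. The
extra running and interaction cost is controlled by `δ` and by energies over `[0, δ]`, hence tends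
to zero with `δ`. If `γ 0 ∉ Ξ`, then `δ < τ(ω)` for small `δ`, the exit cost does not increase, and
the two estimates give `F(γ, Q) ≤ F(ω, Q) + ε`.

If `γ 0 ∈ Ξ`, the detour may exit at a positive time and pay `Ψ(0+) > Ψ(0)`. Comparing `u n` with
detours to the constant curve bounds its cost by `Ψ(0+) + ε`. Either `u n` exits at a positive time
and already pays `Ψ(0+)`, or it starts in `Ξ` and is compared with staying put. In both cases its
running cost is at most `ε`. Hence the running cost of `γ` vanishes and `F(γ, Q) = Ψ(0)`, the least
possible value. -/

/-! ### Convexity and lower semicontinuity under weak convergence -/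

section LowerSemicontinuity

variable {E : Type*} [NormedAddCommGroup E] [InnerProductSpace ℝ E] [FiniteDimensional ℝ E]

/-- A jointly continuous function, nonnegative and convex in its second variable, admits at every
point approximate affine minorants that are stable under perturbation of the first variable. -/
theorem exists_affine_minorant_of_tendsto {X : Type*} [TopologicalSpace X] {f : X → E → ℝ≥0}
    (hf : Continuous (fun z : X × E => f z.1 z.2))
    (hconv : ∀ x, ConvexOn ℝ univ (fun p => (f x p : ℝ))) {u : ℕ → X} {x : X}
    (hu : Tendsto u atTop (𝓝 x)) (p : E) {ε : ℝ} (hε : 0 < ε) :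
    ∃ (ξ : E) (N : ℕ), ∀ n ≥ N, ∀ q : E,
      (f x p : ℝ) + inner ℝ ξ (q - p) ≤ f (u n) q + ε * (1 + ‖q - p‖) := by
  have hfr : Continuous (fun z : X × E => (f z.1 z.2 : ℝ)) := NNReal.continuous_coe.comp hf
  have hfx : ∀ y, Continuous (fun q => (f y q : ℝ)) := fun y =>
    hfr.comp (Continuous.prodMk_right y)
  obtain ⟨l, c, hl, hlc⟩ := (hconv x).exists_affine_le_of_lt (𝕜 := ℝ) (mem_univ p)
    (show (f x p : ℝ) - ε / 3 < f x p by linarith) isClosed_univ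
    ((hfx x).lowerSemicontinuous.lowerSemicontinuousOn _)
  have hl' : ∀ q, l q + c ≤ f x q := fun q => by simpa using hl ⟨q, mem_univ q⟩
  have hlc' : l p + c = f x p - ε / 3 := by simpa using hlc
  have hmin : ∀ q, (f x p : ℝ) - ε / 3 + l (q - p) ≤ f x q := fun q => by
    have := hl' q
    rw [map_sub]; linarith
  -- Compactness of the unit ball around `p` makes `f y` uniformly close to `f x` there, for `y`
  -- near `x`.
  set W : Set (X × E) := {z | |(f z.1 z.2 : ℝ) - f x z.2| < ε / 3} with hW
  have hWo : IsOpen W := by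
    refine isOpen_lt ?_ continuous_const
    exact (hfr.sub ((hfx x).comp continuous_snd)).abs
  obtain ⟨U, V, hU, -, hxU, hpV, hUV⟩ := generalized_tube_lemma (isCompact_singleton (x := x))
    (isCompact_closedBall p 1) hWo (by
      rintro ⟨y, q⟩ ⟨hy, -⟩
      simp only [mem_singleton_iff] at hy
      subst hy
      simp [hW, hε])
  have hclose : ∀ y ∈ U, ∀ q, ‖q - p‖ ≤ 1 → |(f y q : ℝ) - f x q| < ε / 3 := fun y hy q hq =>
    hUV (show (y, q) ∈ U ×ˢ V from ⟨hy, hpV (by rwa [mem_closedBall_iff_norm])⟩)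
  obtain ⟨N, hN⟩ := eventually_atTop.1 (hu.eventually (hU.mem_nhds (hxU rfl)))
  refine ⟨(InnerProductSpace.toDual ℝ E).symm l, N, fun n hn q => ?_⟩
  rw [InnerProductSpace.toDual_symm_apply]
  have hy := hclose (u n) (hN n hn)
  rcases le_or_gt ‖q - p‖ 1 with hq | hq
  · have h1 := abs_lt.1 (hy q hq)
    have h2 := hmin q
    nlinarith [norm_nonneg (q - p)]
  -- Far from `p` there is no uniform closeness. The bound at the point `q₁` of the segment at
  -- distance one is propagated to `q` by convexity of `f (u n)`, at an error linear in `R`; this is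
  -- the source of the factor `1 + ‖q - p‖`.
  · set R := ‖q - p‖ with hR
    have hR0 : 0 < R := by linarith
    set q₁ := p + R⁻¹ • (q - p) with hq₁
    have hq₁p : q₁ - p = R⁻¹ • (q - p) := by simp [hq₁]
    have hn1 : ‖q₁ - p‖ ≤ 1 := by
      rw [hq₁p, norm_smul, norm_inv, Real.norm_eq_abs, abs_of_pos hR0, ← hR,
        inv_mul_cancel₀ hR0.ne']
    have h1 := abs_lt.1 (hy q₁ hn1)
    have h2 := hmin q₁
    have h3 := abs_lt.1 (hy p (by simp))
    rw [hq₁p, map_smul, smul_eq_mul] at h2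
    have hRi : R⁻¹ ≤ 1 := inv_le_one_of_one_le₀ hq.le
    have h4 := (hconv (u n)).2 (mem_univ p) (mem_univ q) (sub_nonneg.2 hRi)
      (inv_nonneg.2 hR0.le) (by ring)
    have hcomb : (1 - R⁻¹) • p + R⁻¹ • q = q₁ := by
      rw [hq₁, smul_sub, sub_smul, one_smul]; abel
    rw [hcomb] at h4
    simp only [smul_eq_mul] at h4
    have h5 : R * (f (u n) q₁ : ℝ) ≤ (R - 1) * f (u n) p + f (u n) q := by
      have := mul_le_mul_of_nonneg_left h4 hR0.le
      have e1 : R * ((1 - R⁻¹) * (f (u n) p : ℝ) + R⁻¹ * f (u n) q)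
          = (R - 1) * f (u n) p + f (u n) q := by field_simp
      linarith
    have h6 : R * ((f x p : ℝ) - ε / 3 + R⁻¹ * l (q - p))
        = R * ((f x p : ℝ) - ε / 3) + l (q - p) := by field_simp
    have h7 : R * ((f x p : ℝ) - ε / 3 + R⁻¹ * l (q - p)) ≤ R * (f (u n) q₁ + ε / 3) :=
      mul_le_mul_of_nonneg_left (by linarith) hR0.le
    have h8 : (R - 1) * (f (u n) p : ℝ) ≤ (R - 1) * (f x p + ε / 3) :=
      mul_le_mul_of_nonneg_left (by linarith) (by linarith)
    nlinarith

variable [MeasurableSpace E] [BorelSpace E]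

theorem ofReal_integral_le_lintegral {T : Type*} [MeasurableSpace T] {μ : Measure T} {g : T → ℝ}
    (hg : Integrable g μ) {a : T → ℝ≥0∞} (h : ∀ᵐ t ∂μ, ENNReal.ofReal (g t) ≤ a t) :
    ENNReal.ofReal (∫ t, g t ∂μ) ≤ ∫⁻ t, a t ∂μ := by
  calc ENNReal.ofReal (∫ t, g t ∂μ) ≤ ENNReal.ofReal (∫ t, max (g t) 0 ∂μ) :=
        ENNReal.ofReal_le_ofReal (integral_mono hg hg.pos_part fun t => le_max_left _ _)
    _ = ∫⁻ t, ENNReal.ofReal (max (g t) 0) ∂μ :=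
        ofReal_integral_eq_lintegral_ofReal hg.pos_part (Eventually.of_forall fun t => le_max_right _ _)
    _ ≤ ∫⁻ t, a t ∂μ := lintegral_mono_ae (h.mono fun t ht => by simpa using ht)

theorem ofReal_sum_le {ι : Type*} (s : Finset ι) (f : ι → ℝ) :
    ENNReal.ofReal (∑ i ∈ s, f i) ≤ ∑ i ∈ s, ENNReal.ofReal (f i) := by
  classical
  induction s using Finset.induction_on with
  | empty => simp
  | insert i s hi ih =>
    rw [Finset.sum_insert hi, Finset.sum_insert hi]
    exact ENNReal.ofReal_add_le.trans (add_le_add_right ih _)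

/-- Lower semicontinuity of integrals under weak convergence, from approximate affine minorants. -/
theorem lintegral_le_liminf_of_affine_minorant {T : Type*} [MeasurableSpace T] {μ : Measure T}
    [IsFiniteMeasure μ] {a : T → ℝ≥0} {b : ℕ → T → ℝ≥0} (ha : Measurable a)
    (hb : ∀ n, Measurable (b n)) {p : T → E} {q : ℕ → T → E} (hp : Integrable p μ)
    (hq : ∀ n, Integrable (q n) μ) (hpm : Measurable p) (hqm : ∀ n, Measurable (q n))
    {C : ℝ} (hC : ∀ n, ∫ t, ‖q n t - p t‖ ∂μ ≤ C)
    (hweak : ∀ B, MeasurableSet B → Tendsto (fun n => ∫ t in B, (q n t - p t) ∂μ) atTop (𝓝 0))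
    (hmin : ∀ᵐ t ∂μ, ∀ ε : ℝ, 0 < ε → ∃ (ξ : E) (N : ℕ), ∀ n ≥ N,
      (a t : ℝ) + inner ℝ ξ (q n t - p t) ≤ b n t + ε * (1 + ‖q n t - p t‖)) :
    ∫⁻ t, a t ∂μ ≤ liminf (fun n => ∫⁻ t, b n t ∂μ) atTop := by
  -- The first two terms come from integrating `1 + ‖q n t - p t‖`; the last one absorbs the weakly
  -- convergent terms, which are eventually larger than `-ε`.
  set D : ℝ := μ.real univ + C + 1 with hD
  have hC0 : 0 ≤ C := (integral_nonneg fun t => norm_nonneg _).trans (hC 0)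
  have hD0 : 0 < D := by have := measureReal_nonneg (μ := μ) (s := univ); linarith
  suffices H : ∀ ε : ℝ, 0 < ε → ∫⁻ t, a t ∂μ ≤
      liminf (fun n => ∫⁻ t, b n t ∂μ) atTop + ENNReal.ofReal (ε * D) by
    refine ENNReal.le_of_forall_pos_le_add fun ε hε _ => ?_
    have := H (ε / D) (by positivity)
    rwa [div_mul_cancel₀ _ hD0.ne', ENNReal.ofReal_coe_nnreal] at this
  intro ε hε
  set ξ := TopologicalSpace.denseSeq E
  -- Slopes are taken from a countable dense set, so no measurable selection is needed: `B k J`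
  -- collects the times at which the `k`-th slope works from index `J` on.
  set B : ℕ → ℕ → Set T := fun k J => {t | ∀ n ≥ J,
    (a t : ℝ) + inner ℝ (ξ k) (q n t - p t) ≤ b n t + ε * (1 + ‖q n t - p t‖)} with hB
  have hBm : ∀ k J, MeasurableSet (B k J) := fun k J => by
    simp only [hB, ofPred_forall]
    refine MeasurableSet.iInter fun n => MeasurableSet.iInter fun _ => ?_
    have h1 := (hqm n).sub hpm
    refine measurableSet_le ?_ ?_
    · exact ha.coe_nnreal_real.add (measurable_const.inner h1)
    · exact (hb n).coe_nnreal_real.add ((measurable_const.add h1.norm).const_mul ε)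
  have hBmono : ∀ k, Monotone (B k) := fun k J J' h t ht n hn => ht n (h.trans hn)
  set G : ℕ → Set T := fun J => (⋃ k ∈ Finset.range (J + 1), B k J) ∩ {t | a t ≤ J} with hG
  have hGm : ∀ J, MeasurableSet (G J) := fun J =>
    (Finset.measurableSet_biUnion _ fun k _ => hBm k J).inter (measurableSet_le ha measurable_const)
  have hGmono : Monotone G := fun J J' h => by
    refine inter_subset_inter ?_ fun t (ht : a t ≤ J) => ht.trans (by exact_mod_cast h)
    intro t ht
    simp only [mem_iUnion, Finset.mem_range] at ht ⊢
    obtain ⟨k, hk, ht⟩ := ht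
    exact ⟨k, by omega, hBmono k h ht⟩
  have hGall : ∀ᵐ t ∂μ, t ∈ ⋃ J, G J := by
    filter_upwards [hmin] with t ht
    obtain ⟨ζ, N, hN⟩ := ht (ε / 2) (by positivity)
    obtain ⟨k, hk⟩ := (TopologicalSpace.denseRange_denseSeq E).exists_dist_lt ζ
      (show 0 < ε / 2 by positivity)
    obtain ⟨A, hA⟩ := exists_nat_ge (a t)
    refine mem_iUnion.2 ⟨max k (max N A), ?_, hA.trans (by simp)⟩
    simp only [mem_iUnion, Finset.mem_range]
    refine ⟨k, by omega, fun n hn => ?_⟩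
    have h1 := hN n (by omega)
    have h2 : inner ℝ (ξ k) (q n t - p t) - inner ℝ ζ (q n t - p t)
        ≤ ε / 2 * ‖q n t - p t‖ := by
      rw [← inner_sub_left]
      refine (real_inner_le_norm _ _).trans ?_
      gcongr
      rw [← dist_eq_norm, dist_comm]; exact hk.le
    nlinarith
  have hmain : ∀ J, ∫⁻ t in G J, a t ∂μ ≤
      liminf (fun n => ∫⁻ t, b n t ∂μ) atTop + ENNReal.ofReal (ε * D) := by
    intro J
    -- On each cell the slope is a constant vector, so weak convergence applies cell by cell.
    set P : ℕ → Set T := fun k => disjointed (fun k => B k J) k ∩ {t | a t ≤ J} with hP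
    have hPm : ∀ k, MeasurableSet (P k) := fun k =>
      (MeasurableSet.disjointed (fun k => hBm k J) k).inter (measurableSet_le ha measurable_const)
    have hPd : Pairwise (Function.onFun Disjoint P) := fun i j hij =>
      (disjoint_disjointed (fun k => B k J) hij).mono inter_subset_left inter_subset_left
    have hGP : G J = ⋃ k ∈ Finset.range (J + 1), P k := by
      simp only [hG, hP]
      rw [← iUnion₂_inter]
      congr 1
      have := biUnion_range_succ_disjointed (fun k => B k J) J
      ext t
      have h1 := Set.ext_iff.1 this t
      simp only [mem_iUnion, Finset.mem_range, Nat.lt_succ_iff] at h1 ⊢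
      simp only [partialSups_eq_biSup] at h1
      simpa using h1.symm
    have hint : ∀ n, Integrable (fun t => q n t - p t) μ := fun n => (hq n).sub hp
    have haJ : IntegrableOn (fun t => (a t : ℝ)) (G J) μ := by
      refine Measure.integrableOn_of_bounded (M := J) (measure_ne_top _ _)
        ha.coe_nnreal_real.aestronglyMeasurable ?_
      filter_upwards [ae_restrict_mem (hGm J)] with t ht
      have : a t ≤ J := ht.2
      rw [Real.norm_of_nonneg (by positivity)]
      exact_mod_cast this
    have hlim : Tendsto (fun n => ∑ k ∈ Finset.range (J + 1),
        inner ℝ (ξ k) (∫ t in P k, (q n t - p t) ∂μ)) atTop (𝓝 0) := by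
      have : Tendsto (fun n => ∑ k ∈ Finset.range (J + 1),
          inner ℝ (ξ k) (∫ t in P k, (q n t - p t) ∂μ)) atTop
          (𝓝 (∑ k ∈ Finset.range (J + 1), inner ℝ (ξ k) (0 : E))) :=
        tendsto_finsetSum _ fun k _ => tendsto_const_nhds.inner (hweak _ (hPm k))
      simpa using this
    rw [← tsub_le_iff_right]
    refine le_liminf_of_le (by isBoundedDefault) ?_
    filter_upwards [hlim.eventually (lt_mem_nhds (neg_lt_zero.2 hε)), eventually_ge_atTop J]
      with n hn hnJ
    rw [tsub_le_iff_right]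
    set g : T → ℝ := fun t => (a t : ℝ) - ε * (1 + ‖q n t - p t‖) with hg
    have hgI : IntegrableOn g (G J) μ :=
      haJ.sub (((integrable_const 1).add (hint n).norm).const_mul ε).integrableOn
    have hIk : ∀ k, IntegrableOn (fun t => inner ℝ (ξ k) (q n t - p t)) (P k) μ := fun k =>
      ((hint n).const_inner (ξ k)).integrableOn
    have key : ENNReal.ofReal (∫ t in G J, g t ∂μ +
        ∑ k ∈ Finset.range (J + 1), inner ℝ (ξ k) (∫ t in P k, (q n t - p t) ∂μ))
        ≤ ∫⁻ t, b n t ∂μ := by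
      have hgP : ∫ t in G J, g t ∂μ = ∑ k ∈ Finset.range (J + 1), ∫ t in P k, g t ∂μ := by
        rw [hGP]
        refine integral_biUnion_finset _ (fun k _ => hPm k) (fun i _ j _ hij => hPd hij) ?_
        intro k hk
        exact hgI.mono_set (hGP ▸ subset_biUnion_of_mem (u := P) hk)
      rw [hgP, ← Finset.sum_add_distrib]
      refine (ofReal_sum_le _ _).trans ?_
      calc _ ≤ ∑ k ∈ Finset.range (J + 1), ∫⁻ t in P k, b n t ∂μ := by
            refine Finset.sum_le_sum fun k hk => ?_
            have hgk : IntegrableOn g (P k) μ :=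
              hgI.mono_set (hGP ▸ subset_biUnion_of_mem (u := P) hk)
            rw [← integral_inner (hint n).integrableOn, ← integral_add hgk (hIk k)]
            refine ofReal_integral_le_lintegral (hgk.add (hIk k)) ?_
            filter_upwards [ae_restrict_mem (hPm k)] with t ht
            have := disjointed_subset (fun k => B k J) k ht.1 n hnJ
            rw [← ENNReal.ofReal_coe_nnreal]
            refine ENNReal.ofReal_le_ofReal ?_
            simp only [hg, Pi.add_apply]; linarith
        _ = ∫⁻ t in ⋃ k ∈ Finset.range (J + 1), P k, b n t ∂μ :=
            (lintegral_biUnion_finset (fun i _ j _ hij => hPd hij) (fun k _ => hPm k) _).symm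
        _ ≤ ∫⁻ t, b n t ∂μ := setLIntegral_le_lintegral _ _
    have hgval : ∫ t in G J, (a t : ℝ) ∂μ - ε * (μ.real univ + C) ≤ ∫ t in G J, g t ∂μ := by
      have h1 : IntegrableOn (fun t => ε * (1 + ‖q n t - p t‖)) (G J) μ :=
        (((integrable_const 1).add (hint n).norm).const_mul ε).integrableOn
      rw [show ∫ t in G J, g t ∂μ = _ from integral_sub haJ h1]
      have h2 : ∫ t in G J, ε * (1 + ‖q n t - p t‖) ∂μ ≤ ∫ t, ε * (1 + ‖q n t - p t‖) ∂μ :=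
        setIntegral_le_integral (((integrable_const 1).add (hint n).norm).const_mul ε)
          (Eventually.of_forall fun t => by positivity)
      have h3 : ∫ t, ε * (1 + ‖q n t - p t‖) ∂μ = ε * (μ.real univ + ∫ t, ‖q n t - p t‖ ∂μ) := by
        rw [integral_const_mul, integral_add (integrable_const 1) (hint n).norm]
        simp
      have h4 := mul_le_mul_of_nonneg_left (add_le_add_right (hC n) (μ.real univ)) hε.le
      linarith
    calc ∫⁻ t in G J, a t ∂μ = ENNReal.ofReal (∫ t in G J, (a t : ℝ) ∂μ) := by
          rw [ofReal_integral_eq_lintegral_ofReal haJ (Eventually.of_forall fun t => by positivity)]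
          simp
      _ ≤ ENNReal.ofReal ((∫ t in G J, g t ∂μ +
          ∑ k ∈ Finset.range (J + 1), inner ℝ (ξ k) (∫ t in P k, (q n t - p t) ∂μ)) + ε * D) := by
          refine ENNReal.ofReal_le_ofReal ?_
          have : ε * D = ε * (μ.real univ + C) + ε := by rw [hD]; ring
          linarith
      _ ≤ _ := ENNReal.ofReal_add_le.trans (add_le_add_left key _)
  calc ∫⁻ t, a t ∂μ = ∫⁻ t in ⋃ J, G J, a t ∂μ := by
        rw [Measure.restrict_eq_self_of_ae_mem hGall]
    _ = ⨆ J, ∫⁻ t in G J, a t ∂μ := setLIntegral_iUnion_of_directed _ hGmono.directed_le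
    _ ≤ _ := iSup_le hmain

end LowerSemicontinuity

/-! ### Absolutely continuous functions with values in a Euclidean space -/

namespace AbsolutelyContinuousOnInterval

section

variable {X Y : Type*} [PseudoMetricSpace X] [PseudoMetricSpace Y]

theorem lipschitzWith_comp {f : ℝ → X} {a b : ℝ} (hf : AbsolutelyContinuousOnInterval f a b)
    {g : X → Y} {K : ℝ≥0} (hg : LipschitzWith K g) :
    AbsolutelyContinuousOnInterval (fun t => g (f t)) a b := by
  refine squeeze_zero (fun E => Finset.sum_nonneg fun _ _ => dist_nonneg) (fun E => ?_)
    (by simpa using Tendsto.const_mul (K : ℝ) hf)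
  rw [Finset.mul_sum]
  exact Finset.sum_le_sum fun i _ => hg.dist_le_mul _ _

/-- Monotonicity keeps the images of disjoint intervals disjoint, and the Lipschitz bound controls
their total length. Used for the time change `catchUp`. -/
theorem comp_monotone_lipschitzWith {f : ℝ → X} {a b c d : ℝ}
    (hf : AbsolutelyContinuousOnInterval f c d) {r : ℝ → ℝ} {K : ℝ≥0} (hr : LipschitzWith K r)
    (hmono : Monotone r) (hmaps : MapsTo r (uIcc a b) (uIcc c d)) :
    AbsolutelyContinuousOnInterval (fun t => f (r t)) a b := by
  rw [absolutelyContinuousOnInterval_iff] at hf ⊢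
  intro ε hε
  obtain ⟨δ, hδ, H⟩ := hf ε hε
  refine ⟨δ / (K + 1), by positivity, fun E hE hlen => ?_⟩
  refine H ⟨E.1, fun i => (r (E.2 i).1, r (E.2 i).2)⟩ ⟨fun i hi => ?_, fun i hi j hj hij => ?_⟩ ?_
  · exact ⟨hmaps (hE.1 i hi).1, hmaps (hE.1 i hi).2⟩
  · have := hE.2 hi hj hij
    simp only [uIoc, Ioc_disjoint_Ioc] at this ⊢
    simpa only [hmono.map_min, hmono.map_max] using hmono this
  · calc ∑ i ∈ Finset.range E.1, dist (r (E.2 i).1) (r (E.2 i).2)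
        ≤ ∑ i ∈ Finset.range E.1, K * dist (E.2 i).1 (E.2 i).2 :=
          Finset.sum_le_sum fun i _ => hr.dist_le_mul _ _
      _ = K * ∑ i ∈ Finset.range E.1, dist (E.2 i).1 (E.2 i).2 := by rw [Finset.mul_sum]
      _ ≤ (K + 1) * ∑ i ∈ Finset.range E.1, dist (E.2 i).1 (E.2 i).2 := by
          gcongr
          linarith
      _ < (K + 1) * (δ / (K + 1)) := by gcongr
      _ = δ := by field_simp

end

variable {E : Type*} [NormedAddCommGroup E] [InnerProductSpace ℝ E]

theorem inner_left {f : ℝ → E} {a b : ℝ} (hf : AbsolutelyContinuousOnInterval f a b) (v : E) :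
    AbsolutelyContinuousOnInterval (fun t => inner ℝ v (f t)) a b :=
  hf.lipschitzWith_comp (innerSL ℝ v).lipschitz

variable [FiniteDimensional ℝ E]

/-- Bounded variation gives differentiability almost everywhere, which reduces the vector-valued
fundamental theorem of calculus to the real one. -/
theorem deriv_inner_ae {f : ℝ → E} {a b : ℝ} (hf : AbsolutelyContinuousOnInterval f a b) (v : E) :
    ∀ᵐ t, t ∈ uIcc a b → deriv (fun t => inner ℝ v (f t)) t = inner ℝ v (deriv f t) := by
  filter_upwards [hf.boundedVariationOn.ae_differentiableAt_of_mem_uIcc] with t ht hmem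
  exact ((innerSL ℝ v).hasFDerivAt.comp_hasDerivAt t (ht hmem).hasDerivAt).deriv

theorem intervalIntegrable_inner_deriv {f : ℝ → E} {a b : ℝ}
    (hf : AbsolutelyContinuousOnInterval f a b) (v : E) :
    IntervalIntegrable (fun t => inner ℝ v (deriv f t)) volume a b := by
  refine (hf.inner_left v).intervalIntegrable_deriv.congr_ae ?_
  rw [EventuallyEq, ae_restrict_iff' measurableSet_uIoc]
  filter_upwards [hf.deriv_inner_ae v] with t ht hmem using ht (uIoc_subset_uIcc hmem)

/-- The derivative of an absolutely continuous function with values in a finite dimensional inner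
product space is integrable. -/
theorem intervalIntegrable_deriv_of_finiteDimensional {f : ℝ → E} {a b : ℝ}
    (hf : AbsolutelyContinuousOnInterval f a b) : IntervalIntegrable (deriv f) volume a b := by
  have h : deriv f = ∑ i, fun t =>
      inner ℝ (stdOrthonormalBasis ℝ E i) (deriv f t) • stdOrthonormalBasis ℝ E i := by
    ext t
    rw [Finset.sum_apply]
    exact ((stdOrthonormalBasis ℝ E).sum_repr' _).symm
  rw [h]
  refine IntervalIntegrable.sum _ fun i _ => ?_
  have := hf.intervalIntegrable_inner_deriv (stdOrthonormalBasis ℝ E i)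
  exact ⟨this.1.smul_const _, this.2.smul_const _⟩

/-- The fundamental theorem of calculus for absolutely continuous functions with values in a finite
dimensional inner product space. -/
theorem integral_deriv_eq_sub_of_finiteDimensional {f : ℝ → E} {a b : ℝ}
    (hf : AbsolutelyContinuousOnInterval f a b) : ∫ t in a..b, deriv f t = f b - f a := by
  refine ext_inner_left ℝ fun v => ?_
  have h1 := (innerSL ℝ v).intervalIntegral_comp_comm
    hf.intervalIntegrable_deriv_of_finiteDimensional
  simp only [innerSL_apply_apply] at h1
  rw [← h1, inner_sub_right, ← (hf.inner_left v).integral_deriv_eq_sub]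
  refine intervalIntegral.integral_congr_ae ?_
  filter_upwards [hf.deriv_inner_ae v] with t ht hmem using (ht (uIoc_subset_uIcc hmem)).symm

end AbsolutelyContinuousOnInterval

/-! ### Lebesgue measure on the half-line -/

namespace MFG

theorem measurableEmbedding_coe : MeasurableEmbedding (fun t : ℝ≥0 => (t : ℝ)) :=
  MeasurableEmbedding.subtype_coe (measurableSet_Ici (a := (0 : ℝ)))

theorem range_nnreal_coe : range (fun t : ℝ≥0 => (t : ℝ)) = Ici 0 := Subtype.range_coe

theorem lebesgue_apply (s : Set ℝ≥0) : lebesgue s = volume ((fun t : ℝ≥0 => (t : ℝ)) '' s) :=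
  measurableEmbedding_coe.comap_apply _ _

theorem image_coe_Iic (T : ℝ≥0) : (fun t : ℝ≥0 => (t : ℝ)) '' Iic T = Icc 0 (T : ℝ) := by
  ext x
  constructor
  · rintro ⟨t, ht, rfl⟩; exact ⟨t.2, ht⟩
  · rintro ⟨h0, hT⟩; exact ⟨⟨x, h0⟩, hT, rfl⟩

theorem lebesgue_Iic (T : ℝ≥0) : lebesgue (Iic T) = T := by
  rw [lebesgue_apply, image_coe_Iic]; simp

instance : SigmaFinite lebesgue :=
  ⟨⟨⟨fun n => Iic (n : ℝ≥0), fun _ => mem_univ _, fun n => by rw [lebesgue_Iic]; simp, by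
    refine eq_univ_of_forall fun t => ?_
    obtain ⟨n, hn⟩ := exists_nat_ge t
    exact mem_iUnion.2 ⟨n, hn⟩⟩⟩⟩

instance : NullSingletonClass lebesgue := ⟨fun t => by rw [lebesgue_apply]; simp⟩

instance (T : ℝ≥0) : IsFiniteMeasure (lebesgue.restrict (Iic T)) :=
  ⟨by rw [Measure.restrict_apply_univ, lebesgue_Iic]; simp⟩

theorem map_restrict_lebesgue (s : Set ℝ≥0) :
    (lebesgue.restrict s).map (fun t : ℝ≥0 => (t : ℝ)) =
      volume.restrict ((fun t : ℝ≥0 => (t : ℝ)) '' s) := by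
  rw [lebesgue, measurableEmbedding_coe.restrict_comap, measurableEmbedding_coe.map_comap,
    Measure.restrict_restrict measurableEmbedding_coe.measurableSet_range,
    inter_eq_self_of_subset_right (image_subset_range _ _)]

theorem setLIntegral_lebesgue (f : ℝ → ℝ≥0∞) (s : Set ℝ≥0) :
    ∫⁻ t in s, f t ∂lebesgue = ∫⁻ t in (fun t : ℝ≥0 => (t : ℝ)) '' s, f t := by
  rw [← map_restrict_lebesgue, measurableEmbedding_coe.lintegral_map]

theorem setIntegral_lebesgue {F : Type*} [NormedAddCommGroup F] [NormedSpace ℝ F] (f : ℝ → F)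
    (s : Set ℝ≥0) :
    ∫ t in s, f t ∂lebesgue = ∫ t in (fun t : ℝ≥0 => (t : ℝ)) '' s, f t := by
  rw [← map_restrict_lebesgue, measurableEmbedding_coe.integral_map]

theorem integrableOn_lebesgue {F : Type*} [NormedAddCommGroup F] {f : ℝ → F}
    {s : Set ℝ≥0} (h : IntegrableOn f ((fun t : ℝ≥0 => (t : ℝ)) '' s)) :
    IntegrableOn (fun t : ℝ≥0 => f t) s lebesgue := by
  rw [IntegrableOn, ← map_restrict_lebesgue, measurableEmbedding_coe.integrable_map_iff] at h
  exact h

end MFG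

/-! ### Equi-integrability -/

section UniformIntegrability

variable {E : Type*} [NormedAddCommGroup E]

/-- Young's inequality in the form that yields equi-integrability from a bound on the `θ`-th
moment. -/
theorem exists_enorm_le_add_mul_rpow {θ : ℝ} (hθ : 1 < θ) {η : ℝ≥0} (hη : 0 < η) :
    ∃ K : ℝ≥0, ∀ p : E, ‖p‖ₑ ≤ K + η * ‖p‖ₑ ^ θ := by
  have h1 : Tendsto (fun r : ℝ≥0 => η * r ^ (θ - 1)) atTop atTop :=
    (NNReal.tendsto_rpow_atTop (by linarith)).const_mul_atTop hη
  obtain ⟨K, hK⟩ := eventually_atTop.1 (h1.eventually_ge_atTop 1)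
  refine ⟨K, fun p => ?_⟩
  rcases le_total ‖p‖₊ K with h | h
  · exact le_add_right (by rw [enorm_eq_nnnorm]; exact_mod_cast h)
  · refine le_add_left ?_
    rcases eq_or_ne p 0 with rfl | hp
    · simp
    have hp' : ‖p‖₊ ≠ 0 := nnnorm_ne_zero_iff.2 hp
    rw [enorm_eq_nnnorm, ← ENNReal.coe_rpow_of_nonneg _ (by linarith)]
    have h2 : ‖p‖₊ ^ θ = ‖p‖₊ ^ (θ - 1) * ‖p‖₊ := by
      rw [← NNReal.rpow_add_one hp']; simp
    have h3 := mul_le_mul_left (hK _ h) ‖p‖₊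
    rw [h2]
    rw [one_mul, mul_assoc] at h3
    exact_mod_cast h3

theorem enorm_rpow_le_one_add_rpow {β θ : ℝ} (hβ : 0 < β) (hβθ : β ≤ θ) (p : E) :
    ‖p‖ₑ ^ β ≤ 1 + ‖p‖ₑ ^ θ := by
  rcases le_total ‖p‖ₑ 1 with h | h
  · exact le_add_right (ENNReal.rpow_le_one h hβ.le)
  · exact le_add_left (ENNReal.rpow_le_rpow_of_exponent_le h hβθ)

variable [NormedSpace ℝ E]

/-- For an equi-integrable sequence, convergence to zero of the integrals over all measurable sets
follows from that over the sets of a generating π-system. -/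
theorem tendsto_setIntegral_zero_of_generateFrom {T : Type*} [mT : MeasurableSpace T]
    {μ : Measure T} [IsFiniteMeasure μ] {g : ℕ → T → E} (hg : ∀ n, Integrable (g n) μ)
    (hui : ∀ ε : ℝ, 0 < ε → ∃ δ : ℝ≥0∞, 0 < δ ∧ ∀ s, MeasurableSet s → μ s ≤ δ →
      ∀ n, ‖∫ t in s, g n t ∂μ‖ ≤ ε)
    {S : Set (Set T)} (hS : mT = MeasurableSpace.generateFrom S) (hpi : IsPiSystem S)
    (huniv : Tendsto (fun n => ∫ t, g n t ∂μ) atTop (𝓝 0))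
    (hbase : ∀ s ∈ S, Tendsto (fun n => ∫ t in s, g n t ∂μ) atTop (𝓝 0))
    {B : Set T} (hB : MeasurableSet B) :
    Tendsto (fun n => ∫ t in B, g n t ∂μ) atTop (𝓝 0) := by
  induction B, hB using MeasurableSpace.induction_on_inter hS hpi with
  | empty => simp
  | basic s hs => exact hbase s hs
  | compl s hs ih =>
    have : ∀ n, ∫ t in sᶜ, g n t ∂μ = ∫ t, g n t ∂μ - ∫ t in s, g n t ∂μ := fun n => by
      rw [← integral_add_compl hs (hg n)]; abel
    simp only [this]
    simpa using huniv.sub ih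
  | iUnion f hd hm ih =>
    rw [Metric.tendsto_nhds]
    intro ε hε
    -- Equi-integrability makes the tail of the disjoint union negligible uniformly in `n`, leaving
    -- a finite sum.
    obtain ⟨δ, hδ, H⟩ := hui (ε / 2) (by positivity)
    set A : ℕ → Set T := fun N => ⋃ i ∈ Finset.range N, f i with hA
    have hAm : ∀ N, MeasurableSet (A N) := fun N => Finset.measurableSet_biUnion _ fun i _ => hm i
    have hAS : ∀ N, A N ⊆ ⋃ i, f i := fun N => iUnion₂_subset fun i _ => subset_iUnion f i
    have hlim : Tendsto (fun N => μ ((⋃ i, f i) \ A N)) atTop (𝓝 0) := by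
      have h0 : ⋂ N, ((⋃ i, f i) \ A N) = ∅ := by
        refine eq_empty_of_forall_notMem fun t ht => ?_
        rw [mem_iInter] at ht
        obtain ⟨i, hi⟩ := mem_iUnion.1 (ht 0).1
        exact (ht (i + 1)).2 (mem_biUnion (Finset.mem_coe.2 (Finset.self_mem_range_succ i)) hi)
      have := tendsto_measure_iInter_atTop (μ := μ) (s := fun N => (⋃ i, f i) \ A N)
        (fun N => ((MeasurableSet.iUnion hm).diff (hAm N)).nullMeasurableSet)
        (fun N N' h => sdiff_subset_sdiff_right
          (biUnion_subset_biUnion_left fun i hi => Finset.range_mono h hi))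
        ⟨0, measure_ne_top _ _⟩
      rwa [h0, measure_empty] at this
    obtain ⟨N, hN⟩ := (hlim.eventually (ge_mem_nhds hδ)).exists
    have hsum : Tendsto (fun n => ∑ i ∈ Finset.range N, ∫ t in f i, g n t ∂μ) atTop (𝓝 0) := by
      simpa using tendsto_finsetSum (Finset.range N) fun i _ => ih i
    filter_upwards [(Metric.tendsto_nhds.1 hsum) (ε / 2) (by positivity)] with n hn
    have hsplit : ∫ t in ⋃ i, f i, g n t ∂μ =
        ∑ i ∈ Finset.range N, ∫ t in f i, g n t ∂μ + ∫ t in (⋃ i, f i) \ A N, g n t ∂μ := by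
      rw [← integral_biUnion_finset _ (fun i _ => hm i) (fun i _ j _ hij => hd hij)
        (fun i _ => (hg n).integrableOn), ← setIntegral_union disjoint_sdiff_right
        ((MeasurableSet.iUnion hm).diff (hAm N)) (hg n).integrableOn (hg n).integrableOn,
        union_sdiff_cancel (hAS N)]
    rw [dist_zero_right] at hn ⊢
    have := H _ ((MeasurableSet.iUnion hm).diff (hAm N)) hN n
    rw [hsplit]
    refine (norm_add_le _ _).trans_lt ?_
    linarith

end UniformIntegrability

/-! ### Velocities, kinetic energy and limits of curves -/

namespace MFG

variable {d : ℕ} (G : MFG d)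

theorem extend_coe (γ : G.Curve) (t : ℝ≥0) :
    G.extend γ t = (γ t : EuclideanSpace ℝ (Fin d)) := by
  simp [extend]

theorem measurable_velocity (γ : G.Curve) : Measurable (G.velocity γ) :=
  (measurable_deriv (G.extend γ)).comp measurable_coe_nnreal_real

variable {G}

theorem IsAC.integrableOn_velocity {γ : G.Curve} (hγ : G.IsAC γ) (T : ℝ≥0) :
    IntegrableOn (G.velocity γ) (Iic T) lebesgue := by
  refine integrableOn_lebesgue ?_
  rw [image_coe_Iic, integrableOn_Icc_iff_integrableOn_Ioc,
    ← intervalIntegrable_iff_integrableOn_Ioc_of_le T.coe_nonneg]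
  exact (hγ T).intervalIntegrable_deriv_of_finiteDimensional

theorem IsAC.integral_velocity {γ : G.Curve} (hγ : G.IsAC γ) (T : ℝ≥0) :
    ∫ t in Iic T, G.velocity γ t ∂lebesgue = (γ T : EuclideanSpace ℝ (Fin d)) - γ 0 := by
  unfold velocity
  rw [setIntegral_lebesgue (fun t => deriv (G.extend γ) t), image_coe_Iic,
    integral_Icc_eq_integral_Ioc, ← intervalIntegral.integral_of_le T.coe_nonneg,
    (hγ T).integral_deriv_eq_sub_of_finiteDimensional, extend_coe]
  simpa using G.extend_coe γ 0

variable (G) in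
/-- The kinetic energy of order `θ` of a curve over a set of times. -/
noncomputable def energyOn (θ : ℝ) (γ : G.Curve) (s : Set ℝ≥0) : ℝ≥0∞ :=
  ∫⁻ t in s, ‖G.velocity γ t‖ₑ ^ θ ∂lebesgue

/-- With `η` small, an energy bound makes velocities equi-integrable; with `η = 1`, it bounds them
in `L¹` over finite times. -/
theorem lintegral_enorm_velocity_le {θ : ℝ} (γ : G.Curve) {K η : ℝ≥0}
    (hK : ∀ p : EuclideanSpace ℝ (Fin d), ‖p‖ₑ ≤ K + η * ‖p‖ₑ ^ θ) (s : Set ℝ≥0) :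
    ∫⁻ t in s, ‖G.velocity γ t‖ₑ ∂lebesgue ≤ K * lebesgue s + η * G.energyOn θ γ univ := by
  calc ∫⁻ t in s, ‖G.velocity γ t‖ₑ ∂lebesgue
      ≤ ∫⁻ t in s, (K + η * ‖G.velocity γ t‖ₑ ^ θ) ∂lebesgue := lintegral_mono fun t => hK _
    _ = K * lebesgue s + η * ∫⁻ t in s, ‖G.velocity γ t‖ₑ ^ θ ∂lebesgue := by
        rw [lintegral_add_left measurable_const, lintegral_const_mul _
          ((G.measurable_velocity γ).enorm.pow_const θ)]
        simp
    _ ≤ _ := by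
        gcongr
        rw [energyOn, Measure.restrict_univ]
        exact setLIntegral_le_lintegral _ _

theorem edist_extend_le {γ : G.Curve} (hγ : G.IsAC γ) {T : ℝ≥0} {a b : ℝ}
    (ha : a ∈ uIcc 0 (T : ℝ)) (hb : b ∈ uIcc 0 (T : ℝ)) :
    edist (G.extend γ a) (G.extend γ b) ≤ ∫⁻ t in uIoc a b, ‖deriv (G.extend γ) t‖ₑ := by
  have h := (hγ T).mono (uIcc_subset_uIcc ha hb)
  rw [edist_comm, edist_eq_enorm_sub, ← h.integral_deriv_eq_sub_of_finiteDimensional,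
    intervalIntegral.intervalIntegral_eq_integral_uIoc, enorm_smul]
  refine le_trans (le_of_eq ?_) (enorm_integral_le_lintegral_enorm _)
  split_ifs <;> simp

theorem energyOn_univ_eq (θ : ℝ) (γ : G.Curve) :
    G.energyOn θ γ univ = ∫⁻ t in Ici (0 : ℝ), ‖deriv (G.extend γ) t‖ₑ ^ θ := by
  unfold energyOn velocity
  rw [setLIntegral_lebesgue (fun t => ‖deriv (G.extend γ) t‖ₑ ^ θ), image_univ, range_nnreal_coe]

theorem tendsto_extend {u : ℕ → G.Curve} {γ : G.Curve} (hu : Tendsto u atTop (𝓝 γ)) (t : ℝ) :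
    Tendsto (fun n => G.extend (u n) t) atTop (𝓝 (G.extend γ t)) :=
  (continuous_subtype_val.tendsto _).comp
    (((continuous_eval_const t.toNNReal).tendsto γ).comp hu)

/-- A limit of curves of uniformly bounded kinetic energy is absolutely continuous. -/
theorem isAC_of_tendsto {θ : ℝ} (hθ : 1 < θ) {u : ℕ → G.Curve} {γ : G.Curve}
    (hu : Tendsto u atTop (𝓝 γ)) (hac : ∀ n, G.IsAC (u n)) {M : ℝ≥0}
    (hM : ∀ n, G.energyOn θ (u n) univ ≤ M) : G.IsAC γ := by
  intro T
  rw [absolutelyContinuousOnInterval_iff]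
  intro ε hε
  obtain ⟨η, hη, hηM⟩ : ∃ η : ℝ≥0, 0 < η ∧ (η : ℝ) * M ≤ ε / 4 := by
    have h0 : 0 < ε / (4 * ((M : ℝ) + 1)) := by positivity
    refine ⟨(ε / (4 * ((M : ℝ) + 1))).toNNReal, Real.toNNReal_pos.2 h0, ?_⟩
    rw [Real.coe_toNNReal _ h0.le, div_mul_eq_mul_div,
      div_le_div_iff₀ (by positivity) (by positivity)]
    nlinarith [M.coe_nonneg]
  obtain ⟨K, hK⟩ := exists_enorm_le_add_mul_rpow (E := EuclideanSpace ℝ (Fin d)) hθ hη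
  -- The length and energy terms are each at most `ε / 4`. The resulting non-strict bound `ε / 2`
  -- survives the limit and is still less than `ε`.
  refine ⟨ε / (4 * (K + 1)), by positivity, fun E hE hlen => ?_⟩
  have hbound : ∀ n, ∑ i ∈ Finset.range E.1,
      dist (G.extend (u n) (E.2 i).1) (G.extend (u n) (E.2 i).2) ≤ ε / 2 := by
    intro n
    have h1 : ∑ i ∈ Finset.range E.1,
        edist (G.extend (u n) (E.2 i).1) (G.extend (u n) (E.2 i).2) ≤
        ENNReal.ofReal (K * (∑ i ∈ Finset.range E.1, dist (E.2 i).1 (E.2 i).2) + η * M) := by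
      calc _ ≤ ∑ i ∈ Finset.range E.1, (K * ENNReal.ofReal (dist (E.2 i).1 (E.2 i).2) +
            η * ∫⁻ t in uIoc (E.2 i).1 (E.2 i).2, ‖deriv (G.extend (u n)) t‖ₑ ^ θ) := by
            refine Finset.sum_le_sum fun i hi =>
              (edist_extend_le (hac n) (hE.1 i hi).1 (hE.1 i hi).2).trans ?_
            refine (lintegral_mono fun t => hK _).trans ?_
            rw [lintegral_add_left measurable_const, lintegral_const_mul _
              ((measurable_deriv _).enorm.pow_const θ)]
            refine add_le_add_left (le_of_eq ?_) _
            rw [lintegral_const, Measure.restrict_apply_univ, uIoc, Real.volume_Ioc, Real.dist_eq,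
              max_sub_min_eq_abs']
        _ = K * ENNReal.ofReal (∑ i ∈ Finset.range E.1, dist (E.2 i).1 (E.2 i).2) +
            η * ∫⁻ t in ⋃ i ∈ Finset.range E.1, uIoc (E.2 i).1 (E.2 i).2,
              ‖deriv (G.extend (u n)) t‖ₑ ^ θ := by
            rw [Finset.sum_add_distrib, ← Finset.mul_sum, ← Finset.mul_sum,
              ENNReal.ofReal_sum_of_nonneg fun _ _ => dist_nonneg,
              lintegral_biUnion_finset hE.2 fun _ _ => measurableSet_uIoc]
        _ ≤ K * ENNReal.ofReal (∑ i ∈ Finset.range E.1, dist (E.2 i).1 (E.2 i).2) + η * M := by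
            gcongr
            refine le_trans (lintegral_mono_set ?_) ((energyOn_univ_eq θ (u n)).symm.trans_le (hM n))
            refine (AbsolutelyContinuousOnInterval.biUnion_uIoc_subset_of_mem_disjWithin hE).trans ?_
            rw [uIoc_of_le T.coe_nonneg]
            exact fun t ht => ht.1.le
        _ = _ := by
            rw [ENNReal.ofReal_add (by positivity) (by positivity),
              ENNReal.ofReal_mul (by positivity), ENNReal.ofReal_mul (by positivity)]
            simp
    simp only [edist_dist] at h1
    rw [← ENNReal.ofReal_sum_of_nonneg fun _ _ => dist_nonneg,
      ENNReal.ofReal_le_ofReal_iff (by positivity)] at h1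
    have h2 : K * (∑ i ∈ Finset.range E.1, dist (E.2 i).1 (E.2 i).2) ≤ ε / 4 := by
      calc _ ≤ K * (ε / (4 * (K + 1))) := by gcongr
        _ ≤ (K + 1) * (ε / (4 * (K + 1))) := by gcongr; linarith
        _ = ε / 4 := by field_simp
    linarith
  have hlim : Tendsto (fun n => ∑ i ∈ Finset.range E.1,
      dist (G.extend (u n) (E.2 i).1) (G.extend (u n) (E.2 i).2)) atTop
      (𝓝 (∑ i ∈ Finset.range E.1, dist (G.extend γ (E.2 i).1) (G.extend γ (E.2 i).2))) :=
    tendsto_finsetSum _ fun i _ => (tendsto_extend hu _).dist (tendsto_extend hu _)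
  exact (le_of_tendsto' hlim hbound).trans_lt (by linarith)

end MFG

/-! ### Weak convergence of velocities and Tonelli's theorem -/

namespace MFG

variable {d : ℕ} {G : MFG d}

/-- Velocities of a convergent sequence of curves of bounded kinetic energy converge weakly. -/
theorem tendsto_setIntegral_velocity_sub {θ : ℝ} (hθ : 1 < θ) {u : ℕ → G.Curve} {γ : G.Curve}
    (hu : Tendsto u atTop (𝓝 γ)) (hac : ∀ n, G.IsAC (u n)) (hγ : G.IsAC γ) {M : ℝ≥0}
    (hM : ∀ n, G.energyOn θ (u n) univ ≤ M) (T : ℝ≥0) {B : Set ℝ≥0} (hB : MeasurableSet B) :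
    Tendsto (fun n => ∫ t in B, (G.velocity (u n) t - G.velocity γ t)
      ∂(lebesgue.restrict (Iic T))) atTop (𝓝 0) := by
  have hint : ∀ n S, IntegrableOn (fun t => G.velocity (u n) t - G.velocity γ t) (Iic S) lebesgue :=
    fun n S => ((hac n).integrableOn_velocity S).sub (hγ.integrableOn_velocity S)
  have hbase : ∀ S, Tendsto (fun n => ∫ t in Iic S, (G.velocity (u n) t - G.velocity γ t) ∂lebesgue)
      atTop (𝓝 0) := by
    intro S
    have h1 : ∀ t : ℝ≥0, Tendsto (fun n => (u n t : EuclideanSpace ℝ (Fin d))) atTop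
        (𝓝 (γ t : EuclideanSpace ℝ (Fin d))) := fun t => by
      simpa only [extend_coe] using tendsto_extend hu t
    have h2 : ∀ n, ∫ t in Iic S, (G.velocity (u n) t - G.velocity γ t) ∂lebesgue =
        ((u n S : EuclideanSpace ℝ (Fin d)) - u n 0) - ((γ S : EuclideanSpace ℝ (Fin d)) - γ 0) :=
      fun n => by
        rw [integral_sub ((hac n).integrableOn_velocity S) (hγ.integrableOn_velocity S),
          (hac n).integral_velocity, hγ.integral_velocity]
    simp only [h2]
    simpa using ((h1 S).sub (h1 0)).sub_const ((γ S : EuclideanSpace ℝ (Fin d)) - γ 0)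
  -- Over `[0, S]` the integral of the velocity is an increment of the curve, so pointwise
  -- convergence suffices. These intervals form a π-system generating the Borel sets, and the energy
  -- bound supplies the equi-integrability.
  refine tendsto_setIntegral_zero_of_generateFrom (fun n => hint n T) ?_
    ((BorelSpace.measurable_eq (α := ℝ≥0)).trans (borel_eq_generateFrom_Iic ℝ≥0)) isPiSystem_Iic
    (hbase T) ?_ hB
  · intro ε hε
    obtain ⟨η, hη, hηM⟩ : ∃ η : ℝ≥0, 0 < η ∧ (η : ℝ) * M ≤ ε / 4 := by
      have h0 : 0 < ε / (4 * ((M : ℝ) + 1)) := by positivity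
      refine ⟨(ε / (4 * ((M : ℝ) + 1))).toNNReal, Real.toNNReal_pos.2 h0, ?_⟩
      rw [Real.coe_toNNReal _ h0.le, div_mul_eq_mul_div,
        div_le_div_iff₀ (by positivity) (by positivity)]
      nlinarith [M.coe_nonneg]
    obtain ⟨K, hK⟩ := exists_enorm_le_add_mul_rpow (E := EuclideanSpace ℝ (Fin d)) hθ hη
    have hfin : ∫⁻ t in Iic T, ‖G.velocity γ t‖ₑ ∂lebesgue ≠ ∞ :=
      (hγ.integrableOn_velocity T).2.ne
    obtain ⟨δ, hδ, Hδ⟩ := exists_pos_setLIntegral_lt_of_measure_lt hfin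
      (ENNReal.ofReal_pos.2 (show 0 < ε / 4 by positivity)).ne'
    -- Absolute continuity of the integral asks for measure strictly below `δ`, while
    -- equi-integrability is phrased with `≤`.
    obtain ⟨δ₁, hδ₁, hδ₁δ⟩ := exists_between hδ
    refine ⟨min δ₁ (ENNReal.ofReal (ε / (4 * (K + 1)))),
      lt_min hδ₁ (ENNReal.ofReal_pos.2 (by positivity)), fun s hs hsδ n => ?_⟩
    rw [← ENNReal.ofReal_le_ofReal_iff hε.le, ofReal_norm]
    have h1 : ∫⁻ t in s, ‖G.velocity γ t‖ₑ ∂(lebesgue.restrict (Iic T)) ≤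
        ENNReal.ofReal (ε / 4) := (Hδ s ((hsδ.trans (min_le_left _ _)).trans_lt hδ₁δ)).le
    have h2 : ∫⁻ t in s, ‖G.velocity (u n) t‖ₑ ∂(lebesgue.restrict (Iic T)) ≤
        ENNReal.ofReal (ε / 4) + ENNReal.ofReal (ε / 4) := by
      rw [Measure.restrict_restrict hs]
      refine (lintegral_enorm_velocity_le (u n) hK _).trans (add_le_add ?_ ?_)
      · rw [← Measure.restrict_apply hs]
        calc K * (lebesgue.restrict (Iic T)) s ≤ K * ENNReal.ofReal (ε / (4 * (K + 1))) := by
              gcongr; exact hsδ.trans (min_le_right _ _)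
          _ = ENNReal.ofReal (K * (ε / (4 * (K + 1)))) := by
              rw [ENNReal.ofReal_mul K.coe_nonneg, ENNReal.ofReal_coe_nnreal]
          _ ≤ ENNReal.ofReal (ε / 4) := by
              refine ENNReal.ofReal_le_ofReal ?_
              rw [mul_div_assoc', div_le_div_iff₀ (by positivity) (by positivity)]
              nlinarith [K.coe_nonneg]
      · calc η * G.energyOn θ (u n) univ ≤ η * M := by gcongr; exact hM n
          _ = ENNReal.ofReal (η * M) := by
              rw [ENNReal.ofReal_mul η.coe_nonneg, ENNReal.ofReal_coe_nnreal,
                ENNReal.ofReal_coe_nnreal]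
          _ ≤ ENNReal.ofReal (ε / 4) := ENNReal.ofReal_le_ofReal hηM
    calc ‖∫ t in s, (G.velocity (u n) t - G.velocity γ t) ∂(lebesgue.restrict (Iic T))‖ₑ
        ≤ ∫⁻ t in s, ‖G.velocity (u n) t - G.velocity γ t‖ₑ ∂(lebesgue.restrict (Iic T)) :=
          enorm_integral_le_lintegral_enorm _
      _ ≤ ∫⁻ t in s, (‖G.velocity (u n) t‖ₑ + ‖G.velocity γ t‖ₑ) ∂(lebesgue.restrict (Iic T)) :=
          lintegral_mono fun t => enorm_sub_le
      _ = ∫⁻ t in s, ‖G.velocity (u n) t‖ₑ ∂(lebesgue.restrict (Iic T)) +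
          ∫⁻ t in s, ‖G.velocity γ t‖ₑ ∂(lebesgue.restrict (Iic T)) :=
          lintegral_add_left (G.measurable_velocity _).enorm _
      _ ≤ ENNReal.ofReal (ε / 4) + ENNReal.ofReal (ε / 4) + ENNReal.ofReal (ε / 4) :=
          add_le_add h2 h1
      _ ≤ ENNReal.ofReal ε := by
          rw [← ENNReal.ofReal_add (by positivity) (by positivity),
            ← ENNReal.ofReal_add (by positivity) (by positivity)]
          exact ENNReal.ofReal_le_ofReal (by linarith)
  · rintro s ⟨S, rfl⟩
    have : ∀ n, ∫ t in Iic S, (G.velocity (u n) t - G.velocity γ t) ∂(lebesgue.restrict (Iic T)) =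
        ∫ t in Iic (min S T), (G.velocity (u n) t - G.velocity γ t) ∂lebesgue := fun n => by
      rw [Measure.restrict_restrict measurableSet_Iic, Iic_inter_Iic]
    simp only [this]
    exact hbase _

/-- A time-dependent cost of the position and the velocity to which Tonelli's lower semicontinuity
theorem applies. -/
structure IsTonelli (G : MFG d)
    (f : ℝ≥0 → closure G.Ω → EuclideanSpace ℝ (Fin d) → ℝ≥0) : Prop where
  continuous : ∀ᵐ t ∂lebesgue,
    Continuous (fun z : closure G.Ω × EuclideanSpace ℝ (Fin d) => f t z.1 z.2)
  convex : ∀ᵐ t ∂lebesgue, ∀ x, ConvexOn ℝ univ (fun p => (f t x p : ℝ))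
  aemeasurable : ∀ γ : G.Curve,
    AEMeasurable (fun t => f t (γ t) (G.velocity γ t)) lebesgue

/-- Tonelli's lower semicontinuity theorem on a compact time interval. -/
theorem IsTonelli.setLIntegral_Iic_le_liminf {f : ℝ≥0 → closure G.Ω → EuclideanSpace ℝ (Fin d) → ℝ≥0}
    (hf : G.IsTonelli f) {θ : ℝ} (hθ : 1 < θ) {u : ℕ → G.Curve} {γ : G.Curve}
    (hu : Tendsto u atTop (𝓝 γ)) (hac : ∀ n, G.IsAC (u n)) {M : ℝ≥0}
    (hM : ∀ n, G.energyOn θ (u n) univ ≤ M) (T : ℝ≥0) :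
    ∫⁻ t in Iic T, f t (γ t) (G.velocity γ t) ∂lebesgue ≤
      liminf (fun n => ∫⁻ t in Iic T, f t (u n t) (G.velocity (u n) t) ∂lebesgue) atTop := by
  have hγ := isAC_of_tendsto hθ hu hac hM
  have hm : ∀ ω : G.Curve, AEMeasurable (fun t => f t (ω t) (G.velocity ω t))
      (lebesgue.restrict (Iic T)) := fun ω => (hf.aemeasurable ω).restrict
  obtain ⟨K, hK⟩ := exists_enorm_le_add_mul_rpow (E := EuclideanSpace ℝ (Fin d)) hθ one_pos
  have hq : ∀ n, IntegrableOn (G.velocity (u n)) (Iic T) lebesgue :=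
    fun n => (hac n).integrableOn_velocity T
  have hp : IntegrableOn (G.velocity γ) (Iic T) lebesgue := hγ.integrableOn_velocity T
  have hC : ∀ n, ∫ t in Iic T, ‖G.velocity (u n) t - G.velocity γ t‖ ∂lebesgue ≤
      (K * T + M : ℝ≥0) + ∫ t in Iic T, ‖G.velocity γ t‖ ∂lebesgue := by
    intro n
    have h1 : ∫ t in Iic T, ‖G.velocity (u n) t‖ ∂lebesgue ≤ (K * T + M : ℝ≥0) := by
      rw [integral_norm_eq_lintegral_enorm (hq n).aestronglyMeasurable]
      refine ENNReal.toReal_le_of_le_ofReal (NNReal.coe_nonneg _) ?_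
      refine (lintegral_enorm_velocity_le (u n) hK _).trans ?_
      rw [ENNReal.ofReal_coe_nnreal, lebesgue_Iic, ENNReal.coe_add, ENNReal.coe_mul,
        ENNReal.coe_one, one_mul]
      exact add_le_add_right (hM n) _
    calc _ ≤ ∫ t in Iic T, (‖G.velocity (u n) t‖ + ‖G.velocity γ t‖) ∂lebesgue :=
          integral_mono ((hq n).sub hp).norm ((hq n).norm.add hp.norm) fun t => norm_sub_le _ _
      _ = _ := integral_add (hq n).norm hp.norm
      _ ≤ _ := add_le_add_left h1 _
  have hmain := lintegral_le_liminf_of_affine_minorant (μ := lebesgue.restrict (Iic T))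
    (hm γ).measurable_mk (fun n => (hm (u n)).measurable_mk) hp hq (G.measurable_velocity γ)
    (fun n => G.measurable_velocity (u n)) hC
    (fun B hB => tendsto_setIntegral_velocity_sub hθ hu hac hγ hM T hB) ?_
  · refine (lintegral_congr_ae ?_).trans_le (hmain.trans_eq (congrArg (liminf · atTop) ?_))
    · filter_upwards [(hm γ).ae_eq_mk] with t ht using by rw [ht]
    · funext n
      refine lintegral_congr_ae ?_
      filter_upwards [(hm (u n)).ae_eq_mk] with t ht using by rw [ht]
  · filter_upwards [ae_restrict_of_ae hf.continuous, ae_restrict_of_ae hf.convex,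
      (hm γ).ae_eq_mk, ae_all_iff.2 fun n => (hm (u n)).ae_eq_mk] with t hc hv h1 h2 ε hε
    obtain ⟨ξ, N, hN⟩ := exists_affine_minorant_of_tendsto hc hv
      (((continuous_eval_const t).tendsto γ).comp hu) (G.velocity γ t) hε
    refine ⟨ξ, N, fun n hn => ?_⟩
    rw [← h1, ← h2 n]
    exact hN n hn _

/-- Tonelli's lower semicontinuity theorem up to lower semicontinuous final times. -/
theorem IsTonelli.setLIntegral_le_liminf {f : ℝ≥0 → closure G.Ω → EuclideanSpace ℝ (Fin d) → ℝ≥0}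
    (hf : G.IsTonelli f) {θ : ℝ} (hθ : 1 < θ) {u : ℕ → G.Curve} {γ : G.Curve}
    (hu : Tendsto u atTop (𝓝 γ)) (hac : ∀ n, G.IsAC (u n)) {M : ℝ≥0}
    (hM : ∀ n, G.energyOn θ (u n) univ ≤ M) {m : ℝ≥0∞} {k : ℕ → ℝ≥0∞}
    (hk : ∀ a < m, ∀ᶠ n in atTop, a < k n) :
    ∫⁻ t in {t : ℝ≥0 | (t : ℝ≥0∞) ≤ m}, f t (γ t) (G.velocity γ t) ∂lebesgue ≤
      liminf (fun n => ∫⁻ t in {t : ℝ≥0 | (t : ℝ≥0∞) ≤ k n},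
        f t (u n t) (G.velocity (u n) t) ∂lebesgue) atTop := by
  rcases eq_or_ne m 0 with rfl | hm
  -- No sequence approaches `0` strictly from below, but then the time set is a null singleton.
  · have : {t : ℝ≥0 | (t : ℝ≥0∞) ≤ 0} = {0} := by ext t; simp
    rw [this, Measure.restrict_singleton, measure_singleton]
    simp
  obtain ⟨s, hs, hsm, hslim⟩ := exists_seq_strictMono_tendsto' (pos_iff_ne_zero.2 hm)
  -- Up to a null endpoint, the time set is exhausted by the compact intervals `[0, s j]`; each lies
  -- in `[0, k n]` for large `n` because `s j < m`.
  have hfin : ∀ j, s j ≠ ∞ := fun j => ((hsm j).2.trans_le le_top).ne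
  have hae : {t : ℝ≥0 | (t : ℝ≥0∞) ≤ m} =ᵐ[lebesgue] ⋃ j, Iic (s j).toNNReal := by
    have h1 : {t : ℝ≥0 | (t : ℝ≥0∞) < m} = ⋃ j, Iic (s j).toNNReal := by
      ext t
      simp only [mem_ofPred_eq, mem_iUnion, mem_Iic]
      refine ⟨fun h => ?_, fun ⟨j, hj⟩ => ?_⟩
      · obtain ⟨j, hj⟩ := (hslim.eventually (lt_mem_nhds h)).exists
        exact ⟨j, by rw [← ENNReal.coe_le_coe, ENNReal.coe_toNNReal (hfin j)]; exact hj.le⟩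
      · refine lt_of_le_of_lt ?_ (hsm j).2
        rwa [← ENNReal.coe_toNNReal (hfin j), ENNReal.coe_le_coe]
    rw [← h1]
    have : ∀ᵐ t ∂lebesgue, t ≠ m.toNNReal := by
      rw [ae_iff]; simp
    filter_upwards [this] with t ht
    refine propext (show (t : ℝ≥0∞) ≤ m ↔ (t : ℝ≥0∞) < m from ⟨fun h => lt_of_le_of_ne h ?_, le_of_lt⟩)
    rintro rfl
    simp at ht
  rw [setLIntegral_congr hae, setLIntegral_iUnion_of_directed]
  · refine iSup_le fun j => (hf.setLIntegral_Iic_le_liminf hθ hu hac hM _).trans ?_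
    refine liminf_le_liminf ?_
    filter_upwards [hk _ (hsm j).2] with n hn
    refine lintegral_mono_set fun t ht => ?_
    refine le_trans ?_ hn.le
    rw [← ENNReal.coe_toNNReal (hfin j)]
    exact_mod_cast ht
  · refine Monotone.directed_le fun i j hij => Iic_subset_Iic.2 ?_
    exact ENNReal.toNNReal_mono (hfin j) (hs.monotone hij)

end MFG

/-! ### Measurability of Carathéodory functions -/

/-- A Carathéodory function agrees with a jointly measurable one for almost every value of the
first variable. -/
theorem exists_measurable_uncurry_of_ae_continuous {T Z : Type*} [MeasurableSpace T]
    {μ : Measure T} [TopologicalSpace Z] [TopologicalSpace.MetrizableSpace Z]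
    [SecondCountableTopology Z] [MeasurableSpace Z] [OpensMeasurableSpace Z] {f : T → Z → ℝ≥0}
    (hm : ∀ z, AEMeasurable (fun t => f t z) μ) (hc : ∀ᵐ t ∂μ, Continuous (f t)) :
    ∃ F : T → Z → ℝ≥0, Measurable (Function.uncurry F) ∧ ∀ᵐ t ∂μ, ∀ z, f t z = F t z := by
  classical
  rcases isEmpty_or_nonempty Z with hZ | hZ
  · exact ⟨f, measurable_of_empty _, Eventually.of_forall fun t z => hZ.elim z⟩
  set D := TopologicalSpace.denseSeq Z
  have hgood : ∀ᵐ t ∂μ, Continuous (f t) ∧ ∀ k, f t (D k) = (hm (D k)).mk _ t :=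
    hc.and (ae_all_iff.2 fun k => (hm (D k)).ae_eq_mk)
  set N := toMeasurable μ {t | ¬ (Continuous (f t) ∧ ∀ k, f t (D k) = (hm (D k)).mk _ t)} with hN
  have hN0 : μ N = 0 := by rw [hN, measure_toMeasurable]; exact hgood
  have hNm : MeasurableSet N := measurableSet_toMeasurable _ _
  have hNc : ∀ t ∉ N, Continuous (f t) ∧ ∀ k, f t (D k) = (hm (D k)).mk _ t := fun t ht => by
    by_contra h
    exact ht (subset_toMeasurable _ _ h)
  -- Outside the null set `N`, `f t` is continuous and agrees at the dense points with measurable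
  -- functions of `t`. Setting it to zero on `N` makes continuity hold for every `t`, so
  -- measurability passes to all `z` by limits.
  set F : T → Z → ℝ≥0 := fun t z => if t ∈ N then 0 else f t z with hF
  have hFc : ∀ t, Continuous (F t) := fun t => by
    by_cases ht : t ∈ N
    · simpa [hF, ht] using continuous_const
    · simpa [hF, ht] using (hNc t ht).1
  have hFD : ∀ k, Measurable fun t => F t (D k) := fun k => by
    have : (fun t => F t (D k)) = fun t => if t ∈ N then 0 else (hm (D k)).mk _ t := by
      funext t
      by_cases ht : t ∈ N
      · simp [hF, ht]
      · simp [hF, ht, ← (hNc t ht).2 k]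
    rw [this]
    exact Measurable.ite hNm measurable_const (hm (D k)).measurable_mk
  have hFz : ∀ z, Measurable fun t => F t z := fun z => by
    let := TopologicalSpace.metrizableSpaceMetric Z
    obtain ⟨w, hw, hwz⟩ := mem_closure_iff_seq_limit.1 (TopologicalSpace.denseRange_denseSeq Z z)
    choose k hk using hw
    refine measurable_of_tendsto_metrizable (f := fun n t => F t (w n)) (fun n => ?_)
      (tendsto_pi_nhds.2 fun t => ((hFc t).tendsto z).comp hwz)
    rw [← hk n]
    exact hFD (k n)
  refine ⟨F, ?_, ?_⟩
  · exact (measurable_uncurry_of_continuous_of_measurable (u := fun z t => F t z) hFc hFz).comp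
      measurable_swap
  · filter_upwards [measure_eq_zero_iff_ae_notMem.1 hN0] with t ht z
    simp [hF, ht]

/-! ### Standing assumptions, exit time and exit cost -/

namespace MFG

variable {d : ℕ}

/-- The standing assumptions on the data of the game. -/
structure Regular (G : MFG d) (θ : ℝ) : Prop where
  isClosed : IsClosed G.Ξ
  one_lt : 1 < θ
  ell_meas : ∀ (x : closure G.Ω) (p : EuclideanSpace ℝ (Fin d)),
    AEMeasurable (fun t : ℝ≥0 => G.ell t x p) lebesgue
  ell_cont : ∀ᵐ t ∂lebesgue,
    Continuous (fun z : closure G.Ω × EuclideanSpace ℝ (Fin d) => G.ell t z.1 z.2)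
  ell_convex : ∀ᵐ t ∂lebesgue, ∀ x : closure G.Ω,
    ConvexOn ℝ univ (fun p : EuclideanSpace ℝ (Fin d) => (G.ell t x p : ℝ))
  ell_lower : ∃ α : ℝ≥0, 0 < α ∧ ∀ (t : ℝ≥0) (x : closure G.Ω) (p : EuclideanSpace ℝ (Fin d)),
    α * ‖p‖ₑ ^ θ ≤ G.ell t x p
  ell_upper : ∃ α' : ℝ≥0, ∀ (t : ℝ≥0) (x : closure G.Ω) (p : EuclideanSpace ℝ (Fin d)),
    (G.ell t x p : ℝ≥0∞) ≤ α' * ‖p‖ₑ ^ θ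
  h_meas : ∀ (x x' : closure G.Ω) (p p' : EuclideanSpace ℝ (Fin d)),
    AEMeasurable (fun t : ℝ≥0 => G.h t x x' p p') lebesgue
  h_cont : ∀ᵐ t ∂lebesgue,
    Continuous (fun z : closure G.Ω × closure G.Ω ×
      EuclideanSpace ℝ (Fin d) × EuclideanSpace ℝ (Fin d) =>
        G.h t z.1 z.2.1 z.2.2.1 z.2.2.2)
  h_convex : ∀ᵐ t ∂lebesgue, ∀ x x' : closure G.Ω,
    ConvexOn ℝ univ (fun q : EuclideanSpace ℝ (Fin d) × EuclideanSpace ℝ (Fin d) =>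
      (G.h t x x' q.1 q.2 : ℝ))
  h_upper : ∃ C : ℝ≥0, ∀ (t : ℝ≥0) (x x' : closure G.Ω) (p p' : EuclideanSpace ℝ (Fin d)),
    (G.h t x x' p p' : ℝ≥0∞) ≤ C * (2 + ‖p‖ₑ ^ θ + ‖p'‖ₑ ^ θ)
  exit_lsc : LowerSemicontinuous G.Ψ
  exit_mono : Monotone G.Ψ
  exit_lower : ∃ a b : ℝ, 0 < a ∧ 0 < b ∧ ∀ t : ℝ≥0, a * t - b ≤ (G.Ψ t : ℝ)

variable {G : MFG d} {θ : ℝ}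

theorem continuous_uncurry_extend (G : MFG d) : Continuous (Function.uncurry G.extend) := by
  refine continuous_subtype_val.comp ?_
  exact (continuous_eval (F := G.Curve)).comp
    (continuous_fst.prodMk (continuous_real_toNNReal.comp continuous_snd))

theorem measurable_uncurry_velocity (G : MFG d) :
    Measurable (fun z : G.Curve × ℝ≥0 => G.velocity z.1 z.2) :=
  (measurable_deriv_with_param G.continuous_uncurry_extend).comp
    (measurable_fst.prodMk (measurable_coe_nnreal_real.comp measurable_snd))

theorem measurable_uncurry_eval (G : MFG d) :
    Measurable (fun z : G.Curve × ℝ≥0 => z.1 z.2) :=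
  (continuous_eval (F := G.Curve)).measurable

theorem Regular.isTonelli_ell (hG : G.Regular θ) : G.IsTonelli G.ell where
  continuous := hG.ell_cont
  convex := hG.ell_convex
  aemeasurable γ := by
    obtain ⟨F, hF, hFe⟩ := exists_measurable_uncurry_of_ae_continuous
      (f := fun t (z : closure G.Ω × EuclideanSpace ℝ (Fin d)) => G.ell t z.1 z.2)
      (fun z => hG.ell_meas z.1 z.2) hG.ell_cont
    refine ⟨fun t => F t (γ t, G.velocity γ t), ?_, ?_⟩
    · exact hF.comp (measurable_id.prodMk (γ.continuous.measurable.prodMk (G.measurable_velocity γ)))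
    · filter_upwards [hFe] with t ht using ht (γ t, G.velocity γ t)

theorem Regular.exists_measurable_h (hG : G.Regular θ) :
    ∃ F : ℝ≥0 → closure G.Ω × closure G.Ω × EuclideanSpace ℝ (Fin d) × EuclideanSpace ℝ (Fin d) →
        ℝ≥0, Measurable (Function.uncurry F) ∧
      ∀ᵐ t ∂lebesgue, ∀ z, G.h t z.1 z.2.1 z.2.2.1 z.2.2.2 = F t z :=
  exists_measurable_uncurry_of_ae_continuous (fun _ => hG.h_meas _ _ _ _) hG.h_cont

/-- Only the first curve varies in the lower semicontinuity argument, so the second is frozen; joint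
convexity restricts to convexity in the first velocity. -/
theorem Regular.isTonelli_h (hG : G.Regular θ) (ω : G.Curve) :
    G.IsTonelli (fun t x p => G.h t x (ω t) p (G.velocity ω t)) where
  continuous := by
    filter_upwards [hG.h_cont] with t ht
    exact ht.comp (f := fun z : closure G.Ω × EuclideanSpace ℝ (Fin d) =>
      (z.1, ω t, z.2, G.velocity ω t)) (by fun_prop)
  convex := by
    filter_upwards [hG.h_convex] with t ht x
    refine ⟨convex_univ, fun p _ q _ a b ha hb hab => ?_⟩
    have := (ht x (ω t)).2 (mem_univ (p, G.velocity ω t)) (mem_univ (q, G.velocity ω t)) ha hb hab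
    simpa [← add_smul, hab] using this
  aemeasurable γ := by
    obtain ⟨F, hF, hFe⟩ := hG.exists_measurable_h
    refine ⟨fun t => F t (γ t, ω t, G.velocity γ t, G.velocity ω t), ?_, ?_⟩
    · exact hF.comp (measurable_id.prodMk (γ.continuous.measurable.prodMk
        (ω.continuous.measurable.prodMk
          ((G.measurable_velocity γ).prodMk (G.measurable_velocity ω)))))
    · filter_upwards [hFe] with t ht using ht (γ t, ω t, G.velocity γ t, G.velocity ω t)

theorem exitTime_le {γ : G.Curve} {t : ℝ≥0} (h : (γ t : EuclideanSpace ℝ (Fin d)) ∈ G.Ξ) :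
    G.exitTime γ ≤ t := iInf₂_le t h

/-- The complement of `Ξ` is open, so a curve avoiding `Ξ` up to time `a` avoids it slightly longer;
this gives the strict inequality. -/
theorem lt_exitTime_iff (hΞ : IsClosed G.Ξ) {γ : G.Curve} {a : ℝ≥0} :
    (a : ℝ≥0∞) < G.exitTime γ ↔ ∀ t ≤ a, (γ t : EuclideanSpace ℝ (Fin d)) ∉ G.Ξ := by
  refine ⟨fun h t ht hmem => ?_, fun h => ?_⟩
  · exact absurd (h.trans_le (exitTime_le hmem)) (not_lt.2 (by exact_mod_cast ht))
  · have hopen : IsOpen {t : ℝ≥0 | (γ t : EuclideanSpace ℝ (Fin d)) ∉ G.Ξ} :=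
      hΞ.isOpen_compl.preimage (continuous_subtype_val.comp γ.continuous)
    obtain ⟨b, hab, hb⟩ := exists_Ico_subset_of_mem_nhds (hopen.mem_nhds (h a le_rfl))
      ⟨a + 1, by simp⟩
    refine lt_of_lt_of_le (ENNReal.coe_lt_coe.2 hab) (le_iInf₂ fun t ht => ?_)
    by_contra! hlt
    rw [ENNReal.coe_lt_coe] at hlt
    rcases le_total t a with hta | hta
    · exact h t hta ht
    · exact hb ⟨hta, hlt⟩ ht

theorem mem_of_exitTime_eq (hΞ : IsClosed G.Ξ) {γ : G.Curve} {T : ℝ≥0} (h : G.exitTime γ = T) :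
    (γ T : EuclideanSpace ℝ (Fin d)) ∈ G.Ξ := by
  have : ¬ (T : ℝ≥0∞) < G.exitTime γ := by rw [h]; exact lt_irrefl _
  rw [lt_exitTime_iff hΞ] at this
  push Not at this
  obtain ⟨t, ht, hmem⟩ := this
  have h1 := exitTime_le hmem
  rw [h, ENNReal.coe_le_coe] at h1
  rwa [le_antisymm h1 ht]

/-- Lower semicontinuity of the exit time: for finite `a`, sending the compact `[0, a]` into an open
set is an open condition in the compact-open topology. -/
theorem isOpen_lt_exitTime (hΞ : IsClosed G.Ξ) (a : ℝ≥0∞) :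
    IsOpen {γ : G.Curve | a < G.exitTime γ} := by
  induction a with
  | top => simp
  | coe a =>
    have : {γ : G.Curve | (a : ℝ≥0∞) < G.exitTime γ} =
        {γ : G.Curve | MapsTo γ (Iic a) (Subtype.val ⁻¹' G.Ξᶜ)} := by
      ext γ
      exact lt_exitTime_iff hΞ
    rw [this]
    refine ContinuousMap.isOpen_setOfPred_mapsTo ?_ (hΞ.isOpen_compl.preimage continuous_subtype_val)
    rw [← Icc_bot]
    exact isCompact_Icc

theorem measurable_exitTime (hΞ : IsClosed G.Ξ) : Measurable G.exitTime :=
  measurable_of_Ioi fun a => (isOpen_lt_exitTime hΞ a).measurableSet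

theorem exitCost_mono (hΨ : Monotone G.Ψ) : Monotone G.exitCost := by
  intro s t hst
  unfold exitCost
  split_ifs with h1 h2 h2
  · exact le_rfl
  · exact absurd (top_le_iff.1 (h1 ▸ hst)) h2
  · exact le_top
  · exact ENNReal.coe_le_coe.2 (hΨ (ENNReal.toNNReal_mono h2 hst))

/-- By monotonicity it suffices to approach `m` strictly from below. At finite `m` this is lower
semicontinuity of `Ψ`; at `m = ∞` it is the lower bound `a * t - b`. -/
theorem Regular.exitCost_le_liminf (hG : G.Regular θ) {m : ℝ≥0∞} {k : ℕ → ℝ≥0∞}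
    (hk : ∀ a < m, ∀ᶠ n in atTop, a < k n) :
    G.exitCost m ≤ liminf (fun n => G.exitCost (k n)) atTop := by
  rcases eq_or_ne m 0 with rfl | hm
  · exact le_liminf_of_le (by isBoundedDefault)
      (Eventually.of_forall fun n => exitCost_mono hG.exit_mono zero_le)
  obtain ⟨s, hs, hsm, hslim⟩ := exists_seq_strictMono_tendsto' (pos_iff_ne_zero.2 hm)
  have hfin : ∀ j, s j ≠ ∞ := fun j => ((hsm j).2.trans_le le_top).ne
  have hle : ∀ j, G.exitCost (s j) ≤ liminf (fun n => G.exitCost (k n)) atTop := fun j =>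
    le_liminf_of_le (by isBoundedDefault)
      ((hk _ (hsm j).2).mono fun n hn => exitCost_mono hG.exit_mono hn.le)
  have hval : ∀ j, G.exitCost (s j) = G.Ψ (s j).toNNReal := fun j => by simp [exitCost, hfin j]
  refine le_of_forall_lt fun c hc => ?_
  suffices ∃ j, c < G.exitCost (s j) by
    obtain ⟨j, hj⟩ := this
    exact hj.trans_le (hle j)
  simp only [hval]
  have hcfin : c ≠ ∞ := (hc.trans_le le_top).ne
  lift c to ℝ≥0 using hcfin
  simp only [ENNReal.coe_lt_coe]
  rcases eq_or_ne m ∞ with rfl | hmt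
  · obtain ⟨a, b, ha, hb, hab⟩ := hG.exit_lower
    have h1 : Tendsto s atTop (𝓝 ∞) := hslim
    obtain ⟨j, hj⟩ := (h1.eventually (lt_mem_nhds
      (ENNReal.coe_lt_top (r := ((c + b) / a).toNNReal)))).exists
    refine ⟨j, ?_⟩
    rw [← ENNReal.coe_toNNReal (hfin j), ENNReal.coe_lt_coe, ← NNReal.coe_lt_coe,
      Real.coe_toNNReal _ (by positivity), div_lt_iff₀ ha] at hj
    rw [← NNReal.coe_lt_coe]
    have := hab (s j).toNNReal
    linarith
  · simp only [exitCost, hmt, if_false, ENNReal.coe_lt_coe] at hc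
    have h1 : Tendsto (fun j => (s j).toNNReal) atTop (𝓝 m.toNNReal) :=
      (ENNReal.tendsto_toNNReal hmt).comp hslim
    exact (h1.eventually (hG.exit_lsc _ _ hc)).exists

/-- The interaction cost is a Borel function of its second argument. -/
theorem Regular.measurable_interaction (hG : G.Regular θ) (γ : G.Curve) :
    Measurable (G.interaction γ) := by
  obtain ⟨F, hF, hFe⟩ := hG.exists_measurable_h
  have hset : MeasurableSet {z : G.Curve × ℝ≥0 |
      (z.2 : ℝ≥0∞) ≤ min (G.exitTime γ) (G.exitTime z.1)} :=
    measurableSet_le measurable_snd.coe_nnreal_ennreal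
      (measurable_const.min ((measurable_exitTime hG.isClosed).comp measurable_fst))
  have hFm : Measurable (fun z : G.Curve × ℝ≥0 => (F z.2 (γ z.2, z.1 z.2, G.velocity γ z.2,
      G.velocity z.1 z.2) : ℝ≥0∞)) := by
    refine Measurable.coe_nnreal_ennreal ?_
    exact hF.comp (measurable_snd.prodMk ((γ.continuous.measurable.comp measurable_snd).prodMk
      (G.measurable_uncurry_eval.prodMk (((G.measurable_velocity γ).comp measurable_snd).prodMk
        G.measurable_uncurry_velocity))))
  have heq : G.interaction γ = fun ω => ∫⁻ t, ({z : G.Curve × ℝ≥0 |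
      (z.2 : ℝ≥0∞) ≤ min (G.exitTime γ) (G.exitTime z.1)}.indicator (fun z => (F z.2 (γ z.2, z.1 z.2,
        G.velocity γ z.2, G.velocity z.1 z.2) : ℝ≥0∞)) (ω, t)) ∂lebesgue := by
    funext ω
    have hs : MeasurableSet {t : ℝ≥0 | (t : ℝ≥0∞) ≤ min (G.exitTime γ) (G.exitTime ω)} :=
      measurableSet_le measurable_coe_nnreal_ennreal measurable_const
    rw [interaction, ← lintegral_indicator hs]
    refine lintegral_congr_ae ?_
    filter_upwards [hFe] with t ht
    simp only [indicator, mem_ofPred_eq]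
    rw [← ht]
  rw [heq]
  exact (hFm.indicator hset).lintegral_prod_right'

end MFG

/-! ### Lower semicontinuity of the cost -/

theorem ENNReal.liminf_add_liminf_le (a b : ℕ → ℝ≥0∞) :
    liminf a atTop + liminf b atTop ≤ liminf (fun n => a n + b n) atTop := by
  simp only [liminf_eq_iSup_iInf_of_nat']
  rw [ENNReal.iSup_add_iSup_of_monotone]
  · refine iSup_mono fun n => le_iInf fun i => add_le_add (iInf_le _ i) (iInf_le _ i)
  all_goals
    intro n m hnm
    refine le_iInf fun i => ?_
    obtain ⟨k, rfl⟩ := Nat.exists_eq_add_of_le hnm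
    refine (iInf_le _ (i + k)).trans (le_of_eq ?_)
    congr 1; omega

namespace MFG

variable {d : ℕ} {G : MFG d} {θ : ℝ} {Q : Measure G.Curve}

theorem isAC_of_cost_ne_top {γ : G.Curve} (h : G.cost Q γ ≠ ∞) :
    G.IsAC γ ∧ ∀ᵐ ω ∂Q, G.IsAC ω := by
  unfold cost at h
  split_ifs at h with h1
  · exact ⟨h1.1, h1.2.1⟩
  · exact absurd rfl h

/-- The measurability clause in `cost` holds automatically, and when the interaction integral is
infinite both sides equal `∞`. -/
theorem Regular.cost_eq (hG : G.Regular θ) (hQ : ∀ᵐ ω ∂Q, G.IsAC ω) {γ : G.Curve}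
    (hγ : G.IsAC γ) :
    G.cost Q γ = G.individualCost γ + ∫⁻ ω, G.interaction γ ω ∂Q := by
  unfold cost
  split_ifs with h
  · rfl
  · have : ¬ ∫⁻ ω, G.interaction γ ω ∂Q < ∞ := fun h' =>
      h ⟨hγ, hQ, (hG.measurable_interaction γ).aemeasurable, h'⟩
    rw [not_lt_top_iff.1 this, add_top]

theorem individualCost_le_cost (γ : G.Curve) : G.individualCost γ ≤ G.cost Q γ := by
  unfold cost
  split_ifs
  · exact le_self_add
  · exact le_top

theorem Regular.exists_energyOn_le (hG : G.Regular θ) : ∃ c : ℝ≥0, ∀ (γ : G.Curve),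
    G.energyOn θ γ univ ≤ c * ∫⁻ t, G.ell t (γ t) (G.velocity γ t) ∂lebesgue := by
  obtain ⟨α, hα, H⟩ := hG.ell_lower
  refine ⟨α⁻¹, fun γ => ?_⟩
  rw [energyOn, Measure.restrict_univ, ← lintegral_const_mul' _ _ ENNReal.coe_ne_top]
  refine lintegral_mono fun t => ?_
  rw [ENNReal.coe_inv hα.ne', ← ENNReal.div_eq_inv_mul,
    ENNReal.le_div_iff_mul_le (Or.inl (ENNReal.coe_ne_zero.2 hα.ne')) (Or.inl ENNReal.coe_ne_top),
    mul_comm]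
  exact H _ _ _

theorem Regular.exists_energyOn_le_cost (hG : G.Regular θ) : ∃ c : ℝ≥0, ∀ (Q : Measure G.Curve)
    (γ : G.Curve), G.energyOn θ γ univ ≤ c * G.cost Q γ := by
  obtain ⟨c, hc⟩ := hG.exists_energyOn_le
  refine ⟨c, fun Q γ => (hc γ).trans ?_⟩
  gcongr
  exact le_self_add.trans (individualCost_le_cost γ)

theorem eventually_lt_exitTime (hΞ : IsClosed G.Ξ) {u : ℕ → G.Curve} {γ : G.Curve}
    (hu : Tendsto u atTop (𝓝 γ)) : ∀ a < G.exitTime γ, ∀ᶠ n in atTop, a < G.exitTime (u n) :=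
  fun a ha => hu.eventually ((isOpen_lt_exitTime hΞ a).mem_nhds ha)

theorem Regular.lintegral_ell_le_liminf (hG : G.Regular θ) {u : ℕ → G.Curve} {γ : G.Curve}
    (hu : Tendsto u atTop (𝓝 γ)) (hac : ∀ n, G.IsAC (u n)) {M : ℝ≥0}
    (hM : ∀ n, G.energyOn θ (u n) univ ≤ M) :
    ∫⁻ t, G.ell t (γ t) (G.velocity γ t) ∂lebesgue ≤
      liminf (fun n => ∫⁻ t, G.ell t (u n t) (G.velocity (u n) t) ∂lebesgue) atTop := by
  simpa using hG.isTonelli_ell.setLIntegral_le_liminf hG.one_lt hu hac hM (m := ∞) (k := fun _ => ∞)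
    (fun a ha => Eventually.of_forall fun _ => ha)

/-- Lower semicontinuity of the cost along sequences of bounded cost. -/
theorem Regular.cost_le_of_tendsto (hG : G.Regular θ) (hQ : ∀ᵐ ω ∂Q, G.IsAC ω)
    {u : ℕ → G.Curve} {γ : G.Curve} (hu : Tendsto u atTop (𝓝 γ)) {M : ℝ≥0}
    (hM : ∀ n, G.cost Q (u n) ≤ M) : G.IsAC γ ∧ G.cost Q γ ≤ M := by
  obtain ⟨c, hc⟩ := hG.exists_energyOn_le_cost
  have hac : ∀ n, G.IsAC (u n) := fun n =>
    (isAC_of_cost_ne_top ((hM n).trans_lt ENNReal.coe_lt_top).ne).1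
  have hE : ∀ n, G.energyOn θ (u n) univ ≤ (c * M : ℝ≥0) := fun n => by
    rw [ENNReal.coe_mul]
    exact (hc Q _).trans (by gcongr; exact hM n)
  have hγ := isAC_of_tendsto hG.one_lt hu hac hE
  refine ⟨hγ, ?_⟩
  have hτ := eventually_lt_exitTime hG.isClosed hu
  have h1 := hG.lintegral_ell_le_liminf hu hac hE
  have h2 := hG.exitCost_le_liminf hτ
  have h3 : ∫⁻ ω, G.interaction γ ω ∂Q ≤
      liminf (fun n => ∫⁻ ω, G.interaction (u n) ω ∂Q) atTop := by
    -- Tonelli's theorem for each frozen `ω`, then Fatou's lemma over `Q`.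
    refine le_trans (lintegral_mono fun ω => ?_)
      (lintegral_liminf_le fun n => hG.measurable_interaction (u n))
    refine (hG.isTonelli_h ω).setLIntegral_le_liminf hG.one_lt hu hac hE fun a ha => ?_
    filter_upwards [hτ a (ha.trans_le (min_le_left _ _))] with n hn
    exact lt_min hn (ha.trans_le (min_le_right _ _))
  rw [hG.cost_eq hQ hγ, individualCost]
  calc _ ≤ _ := add_le_add (add_le_add h1 h2) h3
    _ ≤ _ := add_le_add_left (ENNReal.liminf_add_liminf_le _ _) _
    _ ≤ _ := ENNReal.liminf_add_liminf_le _ _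
    _ ≤ liminf (fun _ => (M : ℝ≥0∞)) atTop := liminf_le_liminf (Eventually.of_forall fun n => by
        have := hM n
        rwa [hG.cost_eq hQ (hac n), individualCost] at this)
    _ = M := liminf_const _

/-- The mean kinetic energy over short initial time intervals is small. -/
theorem tendsto_lintegral_energyOn_Iic [IsProbabilityMeasure Q]
    (hE : ∫⁻ γ, G.energyOn θ γ univ ∂Q ≠ ∞) {s : ℕ → ℝ≥0} (hs : Tendsto s atTop (𝓝 0)) :
    Tendsto (fun n => ∫⁻ γ, G.energyOn θ γ (Iic (s n)) ∂Q) atTop (𝓝 0) := by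
  have hm : Measurable fun z : G.Curve × ℝ≥0 => ‖G.velocity z.1 z.2‖ₑ ^ θ :=
    G.measurable_uncurry_velocity.enorm.pow_const θ
  have h1 : ∫⁻ z, ‖G.velocity z.1 z.2‖ₑ ^ θ ∂(Q.prod lebesgue) ≠ ∞ := by
    rw [lintegral_prod _ hm.aemeasurable]
    simpa [energyOn] using hE
  -- Absolute continuity of the integral on the product space: `Γ × [0, s n]` has measure `s n`
  -- because `Q` is a probability measure.
  have h2 := tendsto_setLIntegral_zero h1 (l := atTop) (s := fun n => univ ×ˢ Iic (s n)) (by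
    have : (Q.prod lebesgue) ∘ (fun n => univ ×ˢ Iic (s n)) = fun n => (s n : ℝ≥0∞) := by
      funext n
      simp [Measure.prod_prod, lebesgue_Iic]
    rw [this]
    rw [← ENNReal.coe_zero]; exact ENNReal.tendsto_coe.2 hs)
  refine h2.congr fun n => ?_
  rw [← Measure.prod_restrict, Measure.restrict_univ, lintegral_prod _ hm.aemeasurable]
  rfl

end MFG

/-! ### Reparametrization by arc length -/

/-- A path of finite length has a reparametrization of speed at most one. -/
theorem Path.exists_lipschitzWith_one {X : Type*} [MetricSpace X] {x y : X} (c : Path x y)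
    (hc : eVariationOn c univ ≠ ∞) :
    ∃ σ : ℝ → X, LipschitzWith 1 σ ∧ (∀ r ≤ 0, σ r = x) ∧
      ∀ r, (eVariationOn c univ).toReal ≤ r → σ r = y := by
  set v : unitInterval → ℝ := fun s => (eVariationOn c (Iic s)).toReal with hv
  have hfin : ∀ S : Set unitInterval, eVariationOn c S ≠ ∞ := fun S =>
    ((eVariationOn.mono c (subset_univ S)).trans_lt (lt_top_iff_ne_top.2 hc)).ne
  have hdist : ∀ s t, s ≤ t → dist (c s) (c t) ≤ v t - v s := by
    intro s t hst
    have h1 : eVariationOn c (Iic s) + edist (c s) (c t) ≤ eVariationOn c (Iic t) :=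
      calc _ ≤ eVariationOn c (Iic s) + eVariationOn c (Icc s t) :=
            add_le_add_right (eVariationOn.edist_le c (left_mem_Icc.2 hst) (right_mem_Icc.2 hst)) _
        _ ≤ eVariationOn c (Iic s ∪ Icc s t) :=
            eVariationOn.add_le_union c fun a ha b hb => le_trans ha hb.1
        _ ≤ _ := eVariationOn.mono c (union_subset (Iic_subset_Iic.2 hst) fun a ha => ha.2)
    have h2 := ENNReal.toReal_mono (hfin _) h1
    rw [ENNReal.toReal_add (hfin _) (edist_ne_top _ _), edist_dist,
      ENNReal.toReal_ofReal dist_nonneg] at h2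
    simp only [hv]; linarith
  have hmono : Monotone v := fun s t hst => by
    have := hdist s t hst
    linarith [dist_nonneg (x := c s) (y := c t)]
  -- A generalized inverse of the arc length `v`, whose continuity is not needed: on the open
  -- interval between `q r` and `q r'` the values of `v` lie in `(r, r']`, and the distance bound
  -- reaches the endpoints by continuity of `c`.
  set q : ℝ → unitInterval := fun r => sSup {s | v s ≤ r} with hq
  have hq_mono : Monotone q := fun r r' h => sSup_le_sSup fun s hs => le_trans hs h
  have hlt : ∀ r s, q r < s → r < v s := fun r s h => by
    by_contra! h'
    exact absurd (le_sSup h' : s ≤ q r) (not_le.2 h)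
  have hgt : ∀ r s, s < q r → v s ≤ r := fun r s h => by
    obtain ⟨s', hs', hss'⟩ := lt_sSup_iff.1 h
    exact (hmono hss'.le).trans hs'
  have hLip : ∀ r r', r ≤ r' → dist (c (q r)) (c (q r')) ≤ r' - r := by
    intro r r' h
    rcases (hq_mono h).eq_or_lt with heq | hne
    · rw [heq, dist_self]; linarith
    have hclosed : IsClosed {z : unitInterval × unitInterval | dist (c z.1) (c z.2) ≤ r' - r} :=
      isClosed_le ((c.continuous.comp continuous_fst).dist (c.continuous.comp continuous_snd))
        continuous_const
    have hsub : Ioo (q r) (q r') ×ˢ Ioo (q r) (q r') ⊆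
        {z : unitInterval × unitInterval | dist (c z.1) (c z.2) ≤ r' - r} := by
      rintro ⟨s, t⟩ ⟨hs, ht⟩
      have a1 := hlt r s hs.1
      have a2 := hlt r t ht.1
      have a3 := hgt r' s hs.2
      have a4 := hgt r' t ht.2
      change dist (c s) (c t) ≤ r' - r
      rcases le_total s t with hst | hst
      · linarith [hdist s t hst]
      · rw [dist_comm]; linarith [hdist t s hst]
    have := closure_minimal hsub hclosed
    rw [closure_prod_eq, closure_Ioo hne.ne] at this
    exact this (show (q r, q r') ∈ _ from ⟨left_mem_Icc.2 hne.le, right_mem_Icc.2 hne.le⟩)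
  have hL : LipschitzWith 1 fun r => c (q r) := by
    refine LipschitzWith.of_dist_le_mul fun r r' => ?_
    rw [NNReal.coe_one, one_mul, Real.dist_eq]
    rcases le_total r r' with h | h
    · rw [abs_sub_comm, abs_of_nonneg (by linarith)]; exact hLip r r' h
    · rw [dist_comm, abs_of_nonneg (by linarith)]; exact hLip r' r h
  have hneg : ∀ r < 0, c (q r) = x := fun r hr => by
    have : q r = 0 := by
      simp only [hq]
      refine le_antisymm (sSup_le fun s hs => ?_) bot_le
      exact absurd (lt_of_le_of_lt hs hr) (not_lt.2 ENNReal.toReal_nonneg)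
    rw [this, c.source]
  refine ⟨_, hL, fun r hr => ?_, fun r hr => ?_⟩
  -- At `r = 0` the point `q 0` need not be `0`, since `c` may rest initially; the value there is
  -- obtained as a limit from `r < 0`.
  · have hcl : IsClosed {r : ℝ | c (q r) = x} := isClosed_eq hL.continuous continuous_const
    have := closure_minimal (s := Iio 0) (fun r hr => hneg r hr) hcl
    rw [closure_Iio] at this
    exact this hr
  · have : q r = 1 := by
      refine le_antisymm le_top (le_sSup ?_)
      refine le_trans ?_ hr
      exact ENNReal.toReal_mono hc (eVariationOn.mono c (subset_univ _))
    simp only [this, c.target]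

/-! ### Detours through a nearby starting point -/

namespace MFG

variable {d : ℕ} {G : MFG d} {θ : ℝ}

/-- The time change that stays at `0` up to time `δ / 2`, runs at double speed until it has caught up
at time `δ`, and is the identity afterwards. -/
noncomputable def catchUp (δ t : ℝ) : ℝ := max 0 (min (2 * t - δ) t)

theorem lipschitzWith_catchUp (δ : ℝ) : LipschitzWith 2 (catchUp δ) := by
  have h1 : LipschitzWith 2 fun t : ℝ => 2 * t - δ := LipschitzWith.of_dist_le_mul fun s t => by
    rw [dist_sub_right, Real.dist_eq, Real.dist_eq, ← mul_sub, abs_mul]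
    simp
  have h2 : LipschitzWith 2 fun t : ℝ => min (2 * t - δ) t := by
    simpa using h1.min (LipschitzWith.id.weaken (by norm_num : (1 : ℝ≥0) ≤ 2))
  have h3 := (LipschitzWith.const (0 : ℝ) (α := ℝ)).max h2
  rwa [max_eq_right zero_le] at h3

theorem monotone_catchUp (δ : ℝ) : Monotone (catchUp δ) := fun s t h => by
  unfold catchUp
  gcongr

theorem catchUp_of_le_half {δ t : ℝ} (h : t ≤ δ / 2) : catchUp δ t = 0 :=
  max_eq_left ((min_le_left _ _).trans (by linarith))

theorem catchUp_of_mem_Icc {δ t : ℝ} (h1 : δ / 2 ≤ t) (h2 : t ≤ δ) : catchUp δ t = 2 * t - δ := by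
  rw [catchUp, min_eq_left (by linarith), max_eq_right (by linarith)]

theorem catchUp_of_le {δ t : ℝ} (h0 : 0 ≤ δ) (h : δ ≤ t) : catchUp δ t = t := by
  rw [catchUp, min_eq_right (by linarith), max_eq_right (by linarith)]

/-- Follow `σ` until it reaches the starting point of `ω`, then follow `ω`, without being late on it
after time `δ`. -/
theorem exists_detour (hΞ : IsClosed G.Ξ) {ω : G.Curve} (hω : G.IsAC ω) {δ κ : ℝ≥0} (hδ : 0 < δ) {y : closure G.Ω}
    {σ : ℝ → closure G.Ω} (hσ : LipschitzWith κ σ) (hσ0 : ∀ t ≤ 0, σ t = y)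
    (hσδ : ∀ t, (δ / 2 : ℝ) ≤ t → σ t = ω 0) (hθ : 1 < θ) :
    ∃ ζ : G.Curve, ζ 0 = y ∧ G.IsAC ζ ∧
      (∀ t > δ, ζ t = ω t ∧ G.velocity ζ t = G.velocity ω t) ∧
      G.exitTime ζ ≤ max (G.exitTime ω) δ ∧
      G.energyOn θ ζ (Iic δ) ≤ κ ^ θ * δ + 2 ^ θ * G.energyOn θ ω (Iic δ) := by
  have hδ' : (0 : ℝ) < δ := hδ
  have hρc : Continuous fun t : ℝ≥0 => ω (catchUp δ t).toNNReal :=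
    ω.continuous.comp (continuous_real_toNNReal.comp
      ((lipschitzWith_catchUp δ).continuous.comp NNReal.continuous_coe))
  let ζ : G.Curve := ⟨fun t => if (t : ℝ) ≤ δ / 2 then σ t else ω (catchUp δ t).toNNReal,
    Continuous.if_le (hσ.continuous.comp NNReal.continuous_coe) hρc NNReal.continuous_coe
      continuous_const fun t ht => by rw [hσδ t ht.ge, catchUp_of_le_half ht.le]; simp⟩
  have hζ1 : ∀ t : ℝ≥0, (t : ℝ) ≤ δ / 2 → ζ t = σ t := fun t ht => if_pos ht
  have hζ2 : ∀ t : ℝ≥0, (δ / 2 : ℝ) ≤ t → ζ t = ω (catchUp δ t).toNNReal := fun t ht => by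
    rcases ht.eq_or_lt with h | h
    · rw [hζ1 t h.ge, hσδ t ht, catchUp_of_le_half h.ge]; simp
    · exact if_neg (not_le.2 h)
  -- For `t ≤ δ / 2` the first term is constant, and afterwards the second vanishes. This turns the
  -- glued curve into a sum, so its absolute continuity needs no gluing argument.
  have hext : ∀ t : ℝ, G.extend ζ t = G.extend ω (catchUp δ t) + ((σ t : EuclideanSpace ℝ (Fin d)) -
      ω 0) := by
    intro t
    rcases le_total t (δ / 2) with h | h
    · rw [catchUp_of_le_half h]
      have : ζ t.toNNReal = σ t := by
        rcases le_total t 0 with h0 | h0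
        · rw [Real.toNNReal_of_nonpos h0, hζ1 0 (by rw [NNReal.coe_zero]; linarith), hσ0 t h0, NNReal.coe_zero,
            hσ0 0 le_rfl]
        · rw [hζ1 _ (by rwa [Real.coe_toNNReal _ h0]), Real.coe_toNNReal _ h0]
      simp only [extend, this, Real.toNNReal_zero]
      abel
    · have h0 : 0 ≤ t := by linarith
      rw [hσδ t h, sub_self, add_zero]
      simp only [extend]
      rw [hζ2 _ (by rwa [Real.coe_toNNReal _ h0]), Real.coe_toNNReal _ h0]
  have hσE : LipschitzWith κ fun t => ((σ t : EuclideanSpace ℝ (Fin d)) - ω 0) :=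
    LipschitzWith.of_dist_le_mul fun s t => by
      rw [dist_sub_right]
      exact hσ.dist_le_mul s t
  have hder1 : ∀ t : ℝ, t < δ / 2 → ‖deriv (G.extend ζ) t‖ₑ ≤ κ := by
    intro t ht
    have : G.extend ζ =ᶠ[𝓝 t] fun s => (σ s : EuclideanSpace ℝ (Fin d)) := by
      filter_upwards [gt_mem_nhds ht] with s hs
      rw [hext, catchUp_of_le_half hs.le]
      simp [extend]
    rw [this.deriv_eq, enorm_le_coe]
    have hs : LipschitzWith κ fun s => (σ s : EuclideanSpace ℝ (Fin d)) :=
      LipschitzWith.of_dist_le_mul fun s t => hσ.dist_le_mul s t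
    exact_mod_cast norm_deriv_le_of_lipschitz hs
  have hder2 : ∀ t : ℝ, (δ / 2 : ℝ) < t → t < δ →
      deriv (G.extend ζ) t = (2 : ℝ) • deriv (G.extend ω) (2 * t - δ) := by
    intro t h1 h2
    have : G.extend ζ =ᶠ[𝓝 t] fun s => G.extend ω (2 * s - δ) := by
      filter_upwards [lt_mem_nhds h1, gt_mem_nhds h2] with s hs1 hs2
      rw [hext, catchUp_of_mem_Icc hs1.le hs2.le, hσδ s hs1.le]
      simp
    rw [this.deriv_eq, deriv_comp_mul_left (2 : ℝ) (fun u => G.extend ω (u - δ)) t,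
      deriv_comp_sub_const]
  have hder3 : ∀ t : ℝ, (δ : ℝ) < t → deriv (G.extend ζ) t = deriv (G.extend ω) t := by
    intro t ht
    refine EventuallyEq.deriv_eq ?_
    filter_upwards [lt_mem_nhds ht] with s hs
    rw [hext, catchUp_of_le hδ'.le hs.le, hσδ s (by linarith)]
    simp
  refine ⟨ζ, ?_, fun T => ?_, fun t ht => ⟨?_, hder3 t ht⟩, ?_, ?_⟩
  · rw [hζ1 0 (by rw [NNReal.coe_zero]; linarith)]; exact hσ0 _ (by simp)
  · have h1 : AbsolutelyContinuousOnInterval (fun t => G.extend ω (catchUp δ t)) 0 T := by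
      refine (hω T).comp_monotone_lipschitzWith (lipschitzWith_catchUp δ) (monotone_catchUp δ) ?_
      rw [uIcc_of_le T.coe_nonneg]
      exact fun t ht => ⟨le_max_left _ _, max_le T.coe_nonneg ((min_le_right _ _).trans ht.2)⟩
    have h2 := (hσE.lipschitzOnWith (s := uIcc 0 (T : ℝ))).absolutelyContinuousOnInterval
    rw [show G.extend ζ = _ from funext hext]
    exact h1.add h2
  · have ht' : (δ : ℝ) < t := ht
    rw [hζ2 t (by linarith), catchUp_of_le hδ'.le ht'.le, Real.toNNReal_coe]
  · rcases eq_or_ne (G.exitTime ω) ∞ with h | h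
    · simp [h]
    obtain ⟨T, hT⟩ : ∃ T : ℝ≥0, (T : ℝ≥0∞) = G.exitTime ω := ⟨_, ENNReal.coe_toNNReal h⟩
    have hmem := mem_of_exitTime_eq hΞ hT.symm
    -- At time `s` the detour stands at `ω T ∈ Ξ`. For `T ≤ δ` the time solves `2 * s - δ = T`.
    obtain ⟨s, hs1, hs2, hs3⟩ : ∃ s : ℝ≥0, (δ / 2 : ℝ) ≤ s ∧ catchUp δ s = T ∧ s ≤ max T δ := by
      rcases le_total δ T with hle | hle
      · have hle' : (δ : ℝ) ≤ T := hle
        exact ⟨T, by linarith, catchUp_of_le hδ'.le hle', le_max_left _ _⟩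
      · have hle' : (T : ℝ) ≤ δ := hle
        have hT0 := T.coe_nonneg
        have hcoe : (((T + δ) / 2 : ℝ≥0) : ℝ) = ((T : ℝ) + δ) / 2 := by push_cast; rfl
        refine ⟨(T + δ) / 2, by rw [hcoe]; linarith, ?_, ?_⟩
        · rw [hcoe, catchUp_of_mem_Icc (by linarith) (by linarith)]; ring
        · refine le_max_of_le_right ?_
          rw [← NNReal.coe_le_coe, hcoe]; linarith
    rw [← hT]
    refine (exitTime_le (t := s) ?_).trans (by exact_mod_cast hs3)
    rwa [hζ2 s hs1, hs2, Real.toNNReal_coe]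
  · set g : ℝ → ℝ≥0∞ := fun t => ‖deriv (G.extend ω) t‖ₑ ^ θ with hg
    have hθ0 : 0 ≤ θ := by linarith
    have hω' : G.energyOn θ ω (Iic δ) = ∫⁻ t in Icc 0 (δ : ℝ), g t := by
      rw [energyOn, ← image_coe_Iic, ← setLIntegral_lebesgue]; rfl
    have hζ' : G.energyOn θ ζ (Iic δ) =
        ∫⁻ t in Icc 0 (δ : ℝ), ‖deriv (G.extend ζ) t‖ₑ ^ θ := by
      rw [← image_coe_Iic, ← setLIntegral_lebesgue (fun t => ‖deriv (G.extend ζ) t‖ₑ ^ θ)]; rfl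
    have hcover : Icc 0 (δ : ℝ) ⊆ (Ico 0 (δ / 2 : ℝ) ∪ Ioo (δ / 2 : ℝ) δ) ∪ {(δ / 2 : ℝ), (δ : ℝ)} := by
      intro t ht
      simp only [mem_union, mem_Ico, mem_Ioo, mem_insert_iff, mem_singleton_iff]
      rcases lt_trichotomy t (δ / 2) with h | h | h
      · exact Or.inl (Or.inl ⟨ht.1, h⟩)
      · exact Or.inr (Or.inl h)
      · rcases ht.2.eq_or_lt with h' | h'
        · exact Or.inr (Or.inr h')
        · exact Or.inl (Or.inr ⟨h, h'⟩)
    have hA : ∫⁻ t in Ico 0 (δ / 2 : ℝ), ‖deriv (G.extend ζ) t‖ₑ ^ θ ≤ κ ^ θ * δ := by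
      calc _ ≤ ∫⁻ _ in Ico 0 (δ / 2 : ℝ), (κ : ℝ≥0∞) ^ θ :=
            setLIntegral_mono' measurableSet_Ico fun t ht =>
              ENNReal.rpow_le_rpow (hder1 t ht.2) hθ0
        _ = κ ^ θ * ENNReal.ofReal (δ / 2) := by simp
        _ ≤ κ ^ θ * ENNReal.ofReal δ := by gcongr; linarith
        _ = κ ^ θ * δ := by rw [ENNReal.ofReal_coe_nnreal]
    have hB : ∫⁻ t in Ioo (δ / 2 : ℝ) δ, ‖deriv (G.extend ζ) t‖ₑ ^ θ ≤
        2 ^ θ * G.energyOn θ ω (Iic δ) := by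
      have himg : (fun t : ℝ => 2 * t - δ) '' Ioo (δ / 2 : ℝ) δ ⊆ Icc 0 (δ : ℝ) := by
        rintro _ ⟨t, ht, rfl⟩
        exact ⟨by linarith [ht.1], by linarith [ht.2]⟩
      have hcv := lintegral_image_eq_lintegral_abs_deriv_mul (f := fun t : ℝ => 2 * t - δ)
        (f' := fun _ => 2) (s := Ioo (δ / 2 : ℝ) δ) measurableSet_Ioo
        (fun t _ => by simpa using (((hasDerivAt_id t).const_mul 2).sub_const (δ : ℝ)).hasDerivWithinAt)
        (fun a _ b _ h => by simpa using h) g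
      calc _ = ∫⁻ t in Ioo (δ / 2 : ℝ) δ, 2 ^ θ * g (2 * t - δ) := by
            refine setLIntegral_congr_fun measurableSet_Ioo fun t ht => ?_
            change _ = 2 ^ θ * ‖deriv (G.extend ω) (2 * t - δ)‖ₑ ^ θ
            have h2 : ‖(2 : ℝ)‖ₑ = 2 := by rw [← ofReal_norm]; norm_num
            rw [hder2 t ht.1 ht.2, enorm_smul, h2, ENNReal.mul_rpow_of_nonneg _ _ hθ0]
        _ = 2 ^ θ * ∫⁻ t in Ioo (δ / 2 : ℝ) δ, g (2 * t - δ) := by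
            rw [lintegral_const_mul']
            exact ENNReal.rpow_ne_top_of_nonneg hθ0 (by simp)
        -- The Jacobian factor `2` is inserted at a loss, to match the change of variables `t ↦ 2 *
        -- t - δ`.
        _ ≤ 2 ^ θ * ∫⁻ t in Ioo (δ / 2 : ℝ) δ, ENNReal.ofReal |2| * g (2 * t - δ) := by
            gcongr with t
            exact le_mul_of_one_le_left zero_le (by norm_num)
        _ ≤ 2 ^ θ * G.energyOn θ ω (Iic δ) := by
            rw [← hcv, hω']
            gcongr
    have hN : ∫⁻ t in {(δ / 2 : ℝ), (δ : ℝ)}, ‖deriv (G.extend ζ) t‖ₑ ^ θ = 0 := by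
      refine setLIntegral_measure_zero _ _ ?_
      exact ((finite_singleton _).insert _).measure_zero _
    rw [hζ']
    calc _ ≤ _ := lintegral_mono_set hcover
      _ ≤ _ := lintegral_union_le _ _ _
      _ ≤ _ := add_le_add_left (lintegral_union_le _ _ _) _
      _ ≤ _ := by rw [hN, add_zero]; exact add_le_add hA hB

end MFG

/-! ### The cost of a detour -/

namespace MFG

variable {d : ℕ} {G : MFG d} {θ : ℝ} {Q : Measure G.Curve}

theorem lintegral_ell_le_add {A : ℝ≥0}
    (hA : ∀ (t : ℝ≥0) (x : closure G.Ω) (p : EuclideanSpace ℝ (Fin d)),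
      (G.ell t x p : ℝ≥0∞) ≤ A * ‖p‖ₑ ^ θ) {ω ζ : G.Curve} {δ : ℝ≥0}
    (hζ : ∀ t > δ, ζ t = ω t ∧ G.velocity ζ t = G.velocity ω t) :
    ∫⁻ t, G.ell t (ζ t) (G.velocity ζ t) ∂lebesgue ≤
      ∫⁻ t, G.ell t (ω t) (G.velocity ω t) ∂lebesgue + A * G.energyOn θ ζ (Iic δ) := by
  rw [← lintegral_add_compl _ (measurableSet_Iic (a := δ)), add_comm]
  refine add_le_add ?_ ?_
  · refine le_trans (le_of_eq ?_) (setLIntegral_le_lintegral (Iic δ)ᶜ _)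
    refine setLIntegral_congr_fun measurableSet_Iic.compl fun t ht => ?_
    have := hζ t (not_le.1 ht)
    change (G.ell t (ζ t) (G.velocity ζ t) : ℝ≥0∞) = G.ell t (ω t) (G.velocity ω t)
    rw [this.1, this.2]
  · rw [energyOn, ← lintegral_const_mul' _ _ ENNReal.coe_ne_top]
    exact lintegral_mono fun t => hA _ _ _

/-- A time after `δ` that precedes the exit of `ζ` also precedes that of `ω`, where both integrands
coincide; up to `δ` the growth bound on `h` is enough. -/
theorem interaction_le_add {C : ℝ≥0}
    (hC : ∀ (t : ℝ≥0) (x x' : closure G.Ω) (p p' : EuclideanSpace ℝ (Fin d)),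
      (G.h t x x' p p' : ℝ≥0∞) ≤ C * (2 + ‖p‖ₑ ^ θ + ‖p'‖ₑ ^ θ)) {ω ζ : G.Curve} {δ : ℝ≥0}
    (hζ : ∀ t > δ, ζ t = ω t ∧ G.velocity ζ t = G.velocity ω t)
    (hτ : G.exitTime ζ ≤ max (G.exitTime ω) δ) (ξ : G.Curve) :
    G.interaction ζ ξ ≤ G.interaction ω ξ +
      C * (2 * δ + G.energyOn θ ζ (Iic δ) + G.energyOn θ ξ (Iic δ)) := by
  set S := {t : ℝ≥0 | (t : ℝ≥0∞) ≤ min (G.exitTime ζ) (G.exitTime ξ)} with hS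
  set S' := {t : ℝ≥0 | (t : ℝ≥0∞) ≤ min (G.exitTime ω) (G.exitTime ξ)} with hS'
  have hcover : S ⊆ (S' ∩ Ioi δ) ∪ Iic δ := by
    intro t ht
    rcases le_or_gt t δ with h | h
    · exact Or.inr h
    · refine Or.inl ⟨show (t : ℝ≥0∞) ≤ min (G.exitTime ω) (G.exitTime ξ) from
        le_min ?_ (le_trans ht (min_le_right _ _)), h⟩
      rcases le_max_iff.1 ((le_trans ht (min_le_left _ _)).trans hτ) with h' | h'
      · exact h'
      · exact absurd (ENNReal.coe_le_coe.1 h') (not_le.2 h)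
  have hS'm : MeasurableSet S' := measurableSet_le measurable_coe_nnreal_ennreal measurable_const
  refine (lintegral_mono_set hcover).trans ((lintegral_union_le _ _ _).trans (add_le_add ?_ ?_))
  · refine le_trans (le_of_eq ?_) (lintegral_mono_set (inter_subset_left (t := Ioi δ)))
    refine setLIntegral_congr_fun (hS'm.inter measurableSet_Ioi) fun t ht => ?_
    have := hζ t ht.2
    change (G.h t (ζ t) (ξ t) (G.velocity ζ t) (G.velocity ξ t) : ℝ≥0∞) =
      G.h t (ω t) (ξ t) (G.velocity ω t) (G.velocity ξ t)
    rw [this.1, this.2]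
  · calc _ ≤ ∫⁻ t in Iic δ, C * (2 + ‖G.velocity ζ t‖ₑ ^ θ + ‖G.velocity ξ t‖ₑ ^ θ) ∂lebesgue :=
          lintegral_mono fun t => hC _ _ _ _ _
      _ = _ := by
          rw [lintegral_const_mul' _ _ ENNReal.coe_ne_top,
            lintegral_add_right _ ((G.measurable_velocity ξ).enorm.pow_const θ),
            lintegral_add_left measurable_const, setLIntegral_const, lebesgue_Iic]
          rfl

/-- The error in the cost of a detour of duration `δ`. -/
noncomputable def detourError (G : MFG d) (θ : ℝ) (Q : Measure G.Curve) (A C : ℝ≥0) (ω : G.Curve)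
    (δ : ℝ≥0) : ℝ≥0∞ :=
  A * (δ + 2 ^ θ * G.energyOn θ ω (Iic δ)) +
    C * (2 * δ + (δ + 2 ^ θ * G.energyOn θ ω (Iic δ)) + ∫⁻ ξ, G.energyOn θ ξ (Iic δ) ∂Q)

theorem tendsto_detourError [IsProbabilityMeasure Q] (hθ : 1 < θ)
    (hQE : ∫⁻ γ, G.energyOn θ γ univ ∂Q ≠ ∞) (A C : ℝ≥0) {ω : G.Curve}
    (hω : G.energyOn θ ω univ ≠ ∞) {s : ℕ → ℝ≥0} (hs : Tendsto s atTop (𝓝 0)) :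
    Tendsto (fun n => G.detourError θ Q A C ω (s n)) atTop (𝓝 0) := by
  have h0 : Tendsto (fun n => (s n : ℝ≥0∞)) atTop (𝓝 0) := by
    rw [← ENNReal.coe_zero]; exact ENNReal.tendsto_coe.2 hs
  have h1 : Tendsto (fun n => G.energyOn θ ω (Iic (s n))) atTop (𝓝 0) := by
    rw [energyOn, Measure.restrict_univ] at hω
    refine tendsto_setLIntegral_zero hω ?_
    simpa [Function.comp_def, lebesgue_Iic] using h0
  have h2 := tendsto_lintegral_energyOn_Iic (θ := θ) hQE hs
  have h3 : Tendsto (fun n => (s n : ℝ≥0∞) + 2 ^ θ * G.energyOn θ ω (Iic (s n))) atTop (𝓝 0) := by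
    simpa using h0.add (ENNReal.Tendsto.const_mul h1
      (Or.inr (ENNReal.rpow_ne_top_of_nonneg (by linarith) (by simp))))
  have h4 : Tendsto (fun n => 2 * (s n : ℝ≥0∞)) atTop (𝓝 0) := by
    simpa using ENNReal.Tendsto.const_mul h0 (Or.inr (by simp : (2 : ℝ≥0∞) ≠ ∞))
  have h5 := ENNReal.Tendsto.const_mul (a := (A : ℝ≥0∞)) h3 (Or.inr ENNReal.coe_ne_top)
  have h6 := ENNReal.Tendsto.const_mul (a := (C : ℝ≥0∞)) ((h4.add h3).add h2)
    (Or.inr ENNReal.coe_ne_top)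
  simpa [detourError] using h5.add h6

/-- A curve can be modified over a short initial time so as to start from a point nearby for the
geodesic distance, with control on the cost. -/
theorem Regular.exists_competitor [IsProbabilityMeasure Q] (hG : G.Regular θ) {A C : ℝ≥0}
    (hA : ∀ (t : ℝ≥0) (x : closure G.Ω) (p : EuclideanSpace ℝ (Fin d)),
      (G.ell t x p : ℝ≥0∞) ≤ A * ‖p‖ₑ ^ θ)
    (hC : ∀ (t : ℝ≥0) (x x' : closure G.Ω) (p p' : EuclideanSpace ℝ (Fin d)),
      (G.h t x x' p p' : ℝ≥0∞) ≤ C * (2 + ‖p‖ₑ ^ θ + ‖p'‖ₑ ^ θ))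
    (hQ : ∀ᵐ ξ ∂Q, G.IsAC ξ) {ω : G.Curve} (hω : G.IsAC ω) {δ : ℝ≥0} (hδ : 0 < δ)
    {y : closure G.Ω} (hy : G.geoDist y (ω 0) < (δ / 2 : ℝ≥0)) :
    ∃ ζ : G.Curve, ζ 0 = y ∧ G.cost Q ζ ≤
      ∫⁻ t, G.ell t (ω t) (G.velocity ω t) ∂lebesgue + G.exitCost (max (G.exitTime ω) δ) +
        ∫⁻ ξ, G.interaction ω ξ ∂Q + G.detourError θ Q A C ω δ := by
  obtain ⟨c, hc⟩ := iInf_lt_iff.1 hy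
  have hcfin : eVariationOn c univ ≠ ∞ := (hc.trans ENNReal.coe_lt_top).ne
  obtain ⟨σ, hσ, hσ0, hσL⟩ := c.exists_lipschitzWith_one hcfin
  have hL : (eVariationOn c univ).toReal ≤ δ / 2 := by
    have := ENNReal.toReal_mono ENNReal.coe_ne_top hc.le
    simpa using this
  obtain ⟨ζ, h0, hζ, hζω, hτ, he⟩ := exists_detour hG.isClosed hω hδ hσ hσ0
    (fun t ht => hσL t (hL.trans ht)) hG.one_lt
  rw [ENNReal.coe_one, ENNReal.one_rpow, one_mul] at he
  refine ⟨ζ, h0, ?_⟩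
  rw [hG.cost_eq hQ hζ, individualCost]
  have h1 := lintegral_ell_le_add hA hζω
  have h2 := exitCost_mono hG.exit_mono hτ
  have h3 : ∫⁻ ξ, G.interaction ζ ξ ∂Q ≤ ∫⁻ ξ, G.interaction ω ξ ∂Q +
      C * (2 * δ + G.energyOn θ ζ (Iic δ) + ∫⁻ ξ, G.energyOn θ ξ (Iic δ) ∂Q) := by
    refine (lintegral_mono fun ξ => interaction_le_add hC hζω hτ ξ).trans (le_of_eq ?_)
    rw [lintegral_add_left (hG.measurable_interaction ω), lintegral_const_mul' _ _
      ENNReal.coe_ne_top, lintegral_add_left measurable_const, lintegral_const]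
    simp
  calc _ ≤ _ := add_le_add (add_le_add h1 h2) h3
    _ = ∫⁻ t, G.ell t (ω t) (G.velocity ω t) ∂lebesgue + G.exitCost (max (G.exitTime ω) δ) +
        ∫⁻ ξ, G.interaction ω ξ ∂Q + (A * G.energyOn θ ζ (Iic δ) +
        C * (2 * δ + G.energyOn θ ζ (Iic δ) + ∫⁻ ξ, G.energyOn θ ξ (Iic δ) ∂Q)) := by ring
    _ ≤ _ := by
        unfold detourError
        gcongr

/-! ### Curves at rest and limits of optimal curves -/

theorem isAC_const (x : closure G.Ω) : G.IsAC (ContinuousMap.const ℝ≥0 x) := fun T =>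
  ((LipschitzWith.const (x : EuclideanSpace ℝ (Fin d))).lipschitzOnWith
    (s := uIcc 0 (T : ℝ))).absolutelyContinuousOnInterval

theorem velocity_const (x : closure G.Ω) (t : ℝ≥0) :
    G.velocity (ContinuousMap.const ℝ≥0 x) t = 0 :=
  deriv_const (t : ℝ) (x : EuclideanSpace ℝ (Fin d))

theorem exitTime_eq_zero {γ : G.Curve} (h : (γ 0 : EuclideanSpace ℝ (Fin d)) ∈ G.Ξ) :
    G.exitTime γ = 0 :=
  le_antisymm ((exitTime_le h).trans_eq ENNReal.coe_zero) zero_le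

theorem interaction_eq_zero {γ : G.Curve} (h : G.exitTime γ = 0) (ω : G.Curve) :
    G.interaction γ ω = 0 := by
  refine setLIntegral_measure_zero _ _ ?_
  have : {t : ℝ≥0 | (t : ℝ≥0∞) ≤ min (G.exitTime γ) (G.exitTime ω)} = {0} := by
    ext t; simp [h]
  rw [this, measure_singleton]

/-- The upper bound on `ell` by a multiple of `‖p‖ ^ θ` forces it to vanish at zero velocity. -/
theorem Regular.lintegral_ell_const (hG : G.Regular θ) (x : closure G.Ω) :
    ∫⁻ t, G.ell t (ContinuousMap.const ℝ≥0 x t) (G.velocity (ContinuousMap.const ℝ≥0 x) t)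
      ∂lebesgue = 0 := by
  obtain ⟨A, hA⟩ := hG.ell_upper
  refine le_antisymm ((lintegral_mono fun t => hA _ _ _).trans (le_of_eq ?_)) zero_le
  have hθ : 0 < θ := by linarith [hG.one_lt]
  simp [velocity_const, ENNReal.zero_rpow_of_pos hθ]

theorem Regular.cost_of_exitTime_eq_zero (hG : G.Regular θ) (hQ : ∀ᵐ ω ∂Q, G.IsAC ω) {γ : G.Curve}
    (hγ : G.IsAC γ) (h : G.exitTime γ = 0) :
    G.cost Q γ = ∫⁻ t, G.ell t (γ t) (G.velocity γ t) ∂lebesgue + G.exitCost 0 := by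
  rw [hG.cost_eq hQ hγ, individualCost, h]
  simp [interaction_eq_zero h]

/-- A limit of optimal curves is optimal. -/
theorem Regular.isOptimal_of_tendsto [IsProbabilityMeasure Q] (hG : G.Regular θ)
    (hgeo : ∀ (x : closure G.Ω) (u : ℕ → closure G.Ω),
      Tendsto u atTop (𝓝 x) → Tendsto (fun n => G.geoDist (u n) x) atTop (𝓝 0))
    (hQ : ∀ᵐ ξ ∂Q, G.IsAC ξ) (hQE : ∫⁻ γ, G.energyOn θ γ univ ∂Q ≠ ∞)
    {u : ℕ → G.Curve} {γ : G.Curve} (hu : Tendsto u atTop (𝓝 γ))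
    (hopt : ∀ n, G.IsOptimal Q (u n)) : G.IsOptimal Q γ := by
  obtain ⟨A, hA⟩ := hG.ell_upper
  obtain ⟨C, hC⟩ := hG.h_upper
  obtain ⟨c, hc⟩ := hG.exists_energyOn_le_cost
  set s : ℕ → ℝ≥0 := fun j => 1 / (j + 1) with hs_def
  have hs : Tendsto s atTop (𝓝 0) := tendsto_one_div_add_atTop_nhds_zero_nat
  have hspos : ∀ j, 0 < s j := fun j => by simp only [hs_def]; positivity
  have hopt' : ∀ n (ω : G.Curve), ω 0 = u n 0 → G.cost Q (u n) ≤ G.cost Q ω := fun n ω h => by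
    rw [hopt n]
    exact iInf₂_le (f := fun (ω : G.Curve) (_ : ω 0 = u n 0) => G.cost Q ω) ω h
  have hgeo' := hgeo (γ 0) (fun n => u n 0) (((continuous_eval_const 0).tendsto γ).comp hu)
  have hupper : ∀ ω : G.Curve, G.IsAC ω → ω 0 = γ 0 → ∀ j, ∀ᶠ n in atTop, G.cost Q (u n) ≤
      ∫⁻ t, G.ell t (ω t) (G.velocity ω t) ∂lebesgue + G.exitCost (max (G.exitTime ω) (s j)) +
        ∫⁻ ξ, G.interaction ω ξ ∂Q + G.detourError θ Q A C ω (s j) := by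
    intro ω hω h0 j
    filter_upwards [hgeo'.eventually (gt_mem_nhds
      (ENNReal.coe_pos.2 (half_pos (hspos j))))] with n hn
    obtain ⟨ζ, hζ0, hζ⟩ := hG.exists_competitor hA hC hQ hω (hspos j) (h0 ▸ hn)
    exact (hopt' n ζ hζ0).trans hζ
  have hlsc : ∀ M : ℝ≥0, (∀ᶠ n in atTop, G.cost Q (u n) ≤ M) → G.IsAC γ ∧ G.cost Q γ ≤ M := by
    intro M hM
    obtain ⟨N, hN⟩ := eventually_atTop.1 hM
    exact hG.cost_le_of_tendsto hQ (hu.comp (tendsto_add_atTop_nat N)) fun n => hN _ (by simp)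
  refine le_antisymm (le_iInf₂ fun ω h0 => ?_) (iInf₂_le (f := fun (ω : G.Curve) (_ : ω 0 = γ 0) => G.cost Q ω) γ rfl)
  rcases eq_or_ne (G.cost Q ω) ∞ with htop | hfin
  · rw [htop]; exact le_top
  have hω := (isAC_of_cost_ne_top hfin).1
  by_cases hΞ : (γ 0 : EuclideanSpace ℝ (Fin d)) ∈ G.Ξ
  · set ω₀ : G.Curve := ContinuousMap.const ℝ≥0 (γ 0) with hω₀
    have hω₀ac : G.IsAC ω₀ := isAC_const _
    have hτ₀ : G.exitTime ω₀ = 0 := exitTime_eq_zero hΞ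
    have hℓ₀ : ∫⁻ t, G.ell t (ω₀ t) (G.velocity ω₀ t) ∂lebesgue = 0 := hG.lintegral_ell_const _
    have hbound : ∀ j, ∀ᶠ n in atTop,
        G.cost Q (u n) ≤ G.exitCost (s j) + G.detourError θ Q A C ω₀ (s j) := by
      intro j
      filter_upwards [hupper ω₀ hω₀ac rfl j] with n hn
      rw [hℓ₀, hτ₀, zero_add, max_eq_right zero_le] at hn
      simpa only [interaction_eq_zero hτ₀, lintegral_zero, add_zero] using hn
    have hω₀E : G.energyOn θ ω₀ univ ≠ ∞ := by
      have hθ : 0 < θ := by linarith [hG.one_lt]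
      simp [energyOn, hω₀, velocity_const, ENNReal.zero_rpow_of_pos hθ]
    have herr := tendsto_detourError (Q := Q) hG.one_lt hQE A C hω₀E hs
    have hexit : ∀ t : ℝ≥0, G.exitCost t = G.Ψ t := fun t => by simp [exitCost]
    -- This is `Ψ(0+)`, possibly larger than `Ψ(0)`: detours to the resting curve may exit only at
    -- time `s j > 0`.
    set m : ℝ≥0∞ := ⨅ (t : ℝ≥0) (_ : 0 < t), G.exitCost t with hm
    have hm_fin : m ≠ ∞ := by
      refine ne_top_of_le_ne_top ?_
        (iInf₂_le (f := fun (t : ℝ≥0) (_ : 0 < t) => G.exitCost t) 1 one_pos)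
      rw [hexit]; exact ENNReal.coe_ne_top
    have hsmall : ∀ ε : ℝ≥0, 0 < ε → ∀ᶠ n in atTop, G.cost Q (u n) ≤ m + ε := by
      intro ε hε
      have hε2 : (0 : ℝ≥0∞) < (ε / 2 : ℝ≥0) := ENNReal.coe_pos.2 (half_pos hε)
      obtain ⟨t, ht⟩ := iInf_lt_iff.1 (ENNReal.lt_add_right hm_fin hε2.ne')
      obtain ⟨ht0, ht⟩ := iInf_lt_iff.1 ht
      obtain ⟨j, hj1, hj2⟩ := ((herr.eventually (gt_mem_nhds hε2)).and
        (hs.eventually (gt_mem_nhds ht0))).exists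
      filter_upwards [hbound j] with n hn
      calc _ ≤ _ := hn
        _ ≤ (m + (ε / 2 : ℝ≥0)) + (ε / 2 : ℝ≥0) := add_le_add
            ((exitCost_mono hG.exit_mono (ENNReal.coe_le_coe.2 hj2.le)).trans ht.le) hj1.le
        _ = m + ε := by rw [add_assoc, ← ENNReal.coe_add, add_halves]
    have hac : ∀ᶠ n in atTop, G.IsAC (u n) := by
      filter_upwards [hsmall 1 one_pos] with n hn
      exact (isAC_of_cost_ne_top (ne_top_of_le_ne_top
        (ENNReal.add_ne_top.2 ⟨hm_fin, ENNReal.coe_ne_top⟩) hn)).1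
    have hell : ∀ ε : ℝ≥0, 0 < ε → ∀ᶠ n in atTop,
        ∫⁻ t, G.ell t (u n t) (G.velocity (u n) t) ∂lebesgue ≤ ε := by
      intro ε hε
      filter_upwards [hsmall ε hε, hac] with n hn hacn
      -- With zero exit time, `u n` starts in `Ξ`, and optimality against staying put forces zero
      -- running cost. Otherwise its exit cost is at least `m`, leaving at most `ε` for the running
      -- cost.
      rcases eq_or_ne (G.exitTime (u n)) 0 with h | h
      · have h1 : (u n 0 : EuclideanSpace ℝ (Fin d)) ∈ G.Ξ :=
          mem_of_exitTime_eq hG.isClosed (by rw [h, ENNReal.coe_zero])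
        have h2 := hopt' n (ContinuousMap.const ℝ≥0 (u n 0)) rfl
        rw [hG.cost_of_exitTime_eq_zero hQ hacn h, hG.cost_of_exitTime_eq_zero hQ (isAC_const _)
          (exitTime_eq_zero (γ := ContinuousMap.const ℝ≥0 (u n 0)) h1), hG.lintegral_ell_const, zero_add] at h2
        have h3 : G.exitCost 0 ≠ ∞ := by
          rw [← ENNReal.coe_zero, hexit]; exact ENNReal.coe_ne_top
        exact (ENNReal.le_of_add_le_add_right h3 (h2.trans_eq (zero_add _).symm)).trans zero_le
      · have h1 : m ≤ G.exitCost (G.exitTime (u n)) := by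
          rcases eq_or_ne (G.exitTime (u n)) ∞ with h' | h'
          · simp [exitCost, h']
          · have := iInf₂_le (f := fun (t : ℝ≥0) (_ : 0 < t) => G.exitCost t)
              (G.exitTime (u n)).toNNReal (ENNReal.toNNReal_pos h h')
            rwa [ENNReal.coe_toNNReal h'] at this
        have h2 := (individualCost_le_cost (Q := Q) (u n)).trans hn
        rw [individualCost, add_comm m] at h2
        exact ENNReal.le_of_add_le_add_right hm_fin ((add_le_add_right h1 _).trans h2)
    obtain ⟨N, hN⟩ := eventually_atTop.1 (hac.and (hell 1 one_pos))
    obtain ⟨c', hc'⟩ := hG.exists_energyOn_le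
    have hu' : Tendsto (fun n => u (n + N)) atTop (𝓝 γ) := hu.comp (tendsto_add_atTop_nat N)
    have hliminf := hG.lintegral_ell_le_liminf hu' (fun n => (hN _ (by simp)).1) (M := c')
      fun n => (hc' _).trans ((mul_le_mul_right (hN _ (by simp)).2 _).trans (by simp))
    have hzero : ∫⁻ t, G.ell t (γ t) (G.velocity γ t) ∂lebesgue = 0 := by
      refine le_antisymm (ENNReal.le_of_forall_pos_le_add fun ε hε _ => ?_) zero_le
      rw [zero_add]
      refine hliminf.trans (liminf_le_of_le (by isBoundedDefault) fun b hb => ?_)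
      obtain ⟨n, hn1, hn2⟩ :=
        (hb.and ((tendsto_add_atTop_nat N).eventually (hell ε hε))).exists
      exact hn1.trans hn2
    have hγ : G.IsAC γ := (hlsc (m.toNNReal + 1) (by
      rw [ENNReal.coe_add, ENNReal.coe_toNNReal hm_fin]; exact hsmall 1 one_pos)).1
    rw [hG.cost_of_exitTime_eq_zero hQ hγ (exitTime_eq_zero hΞ), hzero, zero_add,
      ← exitTime_eq_zero (γ := ω) (h0 ▸ hΞ)]
    exact le_add_self.trans (individualCost_le_cost ω)
  -- Choosing `s j` below this exit time makes the maximum in `hupper` equal to it, so no exit cost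
  -- is lost.
  · have hτ : 0 < G.exitTime ω := by
      rw [← ENNReal.coe_zero, lt_exitTime_iff hG.isClosed]
      intro t ht
      rw [nonpos_iff_eq_zero.1 ht, h0]
      exact hΞ
    have hωE : G.energyOn θ ω univ ≠ ∞ :=
      ((hc Q ω).trans_lt (ENNReal.mul_lt_top ENNReal.coe_lt_top hfin.lt_top)).ne
    have herr := tendsto_detourError (Q := Q) hG.one_lt hQE A C hωE hs
    refine ENNReal.le_of_forall_pos_le_add fun ε hε _ => ?_
    have hs' : Tendsto (fun j => (s j : ℝ≥0∞)) atTop (𝓝 0) := by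
      rw [← ENNReal.coe_zero]; exact ENNReal.tendsto_coe.2 hs
    obtain ⟨j, hj1, hj2⟩ := ((herr.eventually (gt_mem_nhds (ENNReal.coe_pos.2 hε))).and
      (hs'.eventually (gt_mem_nhds hτ))).exists
    have := (hlsc ((G.cost Q ω).toNNReal + ε) ?_).2
    · rwa [ENNReal.coe_add, ENNReal.coe_toNNReal hfin] at this
    · filter_upwards [hupper ω hω h0 j] with n hn
      rw [ENNReal.coe_add, ENNReal.coe_toNNReal hfin]
      refine hn.trans ?_
      rw [max_eq_left hj2.le, hG.cost_eq hQ hω, individualCost]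
      gcongr

end MFG

/-! ### Equilibria and strong equilibria -/

namespace MFG

variable {d : ℕ} {G : MFG d} {θ : ℝ} {Q : Measure G.Curve} {m₀ : Measure (closure G.Ω)}

theorem IsStrongEquilibrium.isEquilibrium (h : G.IsStrongEquilibrium m₀ Q) :
    G.IsEquilibrium m₀ Q :=
  ⟨h.1, h.2.1, by filter_upwards [Measure.support_mem_ae (μ := Q)] with γ hγ using h.2.2 γ hγ⟩

theorem Regular.isStrongEquilibrium [IsProbabilityMeasure Q] (hG : G.Regular θ)
    (hgeo : ∀ (x : closure G.Ω) (u : ℕ → closure G.Ω),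
      Tendsto u atTop (𝓝 x) → Tendsto (fun n => G.geoDist (u n) x) atTop (𝓝 0))
    (h : G.IsEquilibrium m₀ Q) : G.IsStrongEquilibrium m₀ Q := by
  obtain ⟨h1, h2, h3⟩ := h
  refine ⟨h1, h2, fun γ hγ => ?_⟩
  have hQ : ∀ᵐ ξ ∂Q, G.IsAC ξ := by
    obtain ⟨ω, hω⟩ : ∃ ω, G.cost Q ω ≠ ∞ := by
      by_contra! hall
      simp [hall] at h2
    exact (isAC_of_cost_ne_top hω).2
  have hQE : ∫⁻ ω, G.energyOn θ ω univ ∂Q ≠ ∞ := by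
    obtain ⟨c, hc⟩ := hG.exists_energyOn_le_cost
    refine ne_top_of_le_ne_top (ENNReal.mul_ne_top (ENNReal.coe_ne_top (r := c)) h2.ne) ?_
    rw [← lintegral_const_mul' _ _ ENNReal.coe_ne_top]
    exact lintegral_mono fun ω => hc Q ω
  have hcl : γ ∈ closure {ω | G.IsOptimal Q ω} := by
    refine mem_closure_iff_nhds.2 fun U hU => ?_
    have hpos : 0 < Q U := (Measure.mem_support_iff_forall γ).1 hγ U hU
    by_contra hempty
    rw [not_nonempty_iff_eq_empty] at hempty
    have hsub : U ⊆ {ω | ¬ G.IsOptimal Q ω} := by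
      intro ω hω
      rw [mem_ofPred_eq]
      intro hopt
      exact (hempty.subset ⟨hω, hopt⟩ : ω ∈ (∅ : Set G.Curve))
    exact hpos.ne' (measure_mono_null hsub (ae_iff.1 h3))
  obtain ⟨u, hu, hlim⟩ := mem_closure_iff_seq_limit.1 hcl
  exact hG.isOptimal_of_tendsto hgeo hQ hQE hlim hu

end MFG

theorem mainTheorem7 (d : ℕ) (hd : 0 < d) (G : MFG d)
    -- the domain and the target set
    (hΩ_nonempty : G.Ω.Nonempty) (hΩ_open : IsOpen G.Ω) (hΩ_bdd : Bornology.IsBounded G.Ω)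
    (hΞ_sub : G.Ξ ⊆ closure G.Ω) (hΞ_nonempty : G.Ξ.Nonempty) (hΞ_closed : IsClosed G.Ξ)
    -- the individual running cost
    (θ : ℝ) (hθ : 1 < θ)
    (hell_meas : ∀ (x : closure G.Ω) (p : EuclideanSpace ℝ (Fin d)),
      AEMeasurable (fun t : ℝ≥0 => G.ell t x p) MFG.lebesgue)
    (hell_cont : ∀ᵐ t ∂MFG.lebesgue,
      Continuous (fun z : closure G.Ω × EuclideanSpace ℝ (Fin d) => G.ell t z.1 z.2))
    (hell_convex : ∀ᵐ t ∂MFG.lebesgue, ∀ x : closure G.Ω,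
      ConvexOn ℝ univ (fun p : EuclideanSpace ℝ (Fin d) => (G.ell t x p : ℝ)))
    (hell_lower : ∃ α : ℝ, 0 < α ∧ ∀ (t : ℝ≥0) (x : closure G.Ω) (p : EuclideanSpace ℝ (Fin d)),
      α * ‖p‖ ^ θ ≤ (G.ell t x p : ℝ))
    -- the interaction cost
    (hh_meas : ∀ (x x' : closure G.Ω) (p p' : EuclideanSpace ℝ (Fin d)),
      AEMeasurable (fun t : ℝ≥0 => G.h t x x' p p') MFG.lebesgue)
    (hh_cont : ∀ᵐ t ∂MFG.lebesgue,
      Continuous (fun z : closure G.Ω × closure G.Ω ×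
        EuclideanSpace ℝ (Fin d) × EuclideanSpace ℝ (Fin d) =>
          G.h t z.1 z.2.1 z.2.2.1 z.2.2.2))
    (hh_convex : ∀ᵐ t ∂MFG.lebesgue, ∀ x x' : closure G.Ω,
      ConvexOn ℝ univ (fun q : EuclideanSpace ℝ (Fin d) × EuclideanSpace ℝ (Fin d) =>
        (G.h t x x' q.1 q.2 : ℝ)))
    (hh_symm : ∀ (t : ℝ≥0) (x x' : closure G.Ω) (p p' : EuclideanSpace ℝ (Fin d)),
      G.h t x x' p p' = G.h t x' x p' p)
    (hh_upper : ∃ C β : ℝ, 0 < C ∧ 0 < β ∧ β ≤ θ ∧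
      ∀ (t : ℝ≥0) (x x' : closure G.Ω) (p p' : EuclideanSpace ℝ (Fin d)),
        (G.h t x x' p p' : ℝ) ≤ C * (‖p‖ ^ β + ‖p'‖ ^ β))
    -- the exit cost
    (hΨ_lsc : LowerSemicontinuous G.Ψ) (hΨ_mono : Monotone G.Ψ)
    (hΨ_lower : ∃ a b : ℝ, 0 < a ∧ 0 < b ∧ ∀ t : ℝ≥0, a * t - b ≤ (G.Ψ t : ℝ))
    -- accessibility of the target set with bounded individual cost
    (haccess : ∃ κ : ℝ≥0, 0 < κ ∧ ∀ x₀ : closure G.Ω, ∃ γ : G.Curve,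
      G.IsAC γ ∧ γ 0 = x₀ ∧ G.individualCost γ ≤ κ)
    -- Euclidean convergence implies convergence for the geodesic distance
    (hgeo : ∀ (x : closure G.Ω) (u : ℕ → closure G.Ω),
      Tendsto u atTop (𝓝 x) → Tendsto (fun n => G.geoDist (u n) x) atTop (𝓝 0))
    -- upper bound on the individual running cost
    (hell_upper : ∃ α' : ℝ, 0 < α' ∧
      ∀ (t : ℝ≥0) (x : closure G.Ω) (p : EuclideanSpace ℝ (Fin d)),
        (G.ell t x p : ℝ) ≤ α' * ‖p‖ ^ θ)
    -- the initial distribution of the agents and the distribution of their trajectories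
    (m₀ : Measure (closure G.Ω)) [IsProbabilityMeasure m₀]
    (Q : Measure G.Curve) [IsProbabilityMeasure Q] :
    G.IsEquilibrium m₀ Q ↔ G.IsStrongEquilibrium m₀ Q := by
  have hofReal : ∀ (p : EuclideanSpace ℝ (Fin d)) {r : ℝ}, 0 < r →
      ENNReal.ofReal (‖p‖ ^ r) = ‖p‖ₑ ^ r := fun p r hr => by
    rw [← ofReal_norm, ENNReal.ofReal_rpow_of_nonneg (norm_nonneg _) hr.le]
  have hθ0 : 0 < θ := by linarith
  have hG : G.Regular θ :=
    { isClosed := hΞ_closed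
      one_lt := hθ
      ell_meas := hell_meas
      ell_cont := hell_cont
      ell_convex := hell_convex
      ell_lower := by
        obtain ⟨α, hα, H⟩ := hell_lower
        refine ⟨α.toNNReal, Real.toNNReal_pos.2 hα, fun t x p => ?_⟩
        have := ENNReal.ofReal_le_ofReal (H t x p)
        rwa [ENNReal.ofReal_mul hα.le, hofReal p hθ0, ENNReal.ofReal_coe_nnreal] at this
      ell_upper := by
        obtain ⟨α, hα, H⟩ := hell_upper
        refine ⟨α.toNNReal, fun t x p => ?_⟩
        have := ENNReal.ofReal_le_ofReal (H t x p)
        rwa [ENNReal.ofReal_mul hα.le, hofReal p hθ0, ENNReal.ofReal_coe_nnreal] at this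
      h_meas := hh_meas
      h_cont := hh_cont
      h_convex := hh_convex
      h_upper := by
        obtain ⟨C, β, hC, hβ, hβθ, H⟩ := hh_upper
        refine ⟨C.toNNReal, fun t x x' p p' => ?_⟩
        have := ENNReal.ofReal_le_ofReal (H t x x' p p')
        rw [ENNReal.ofReal_mul hC.le, ENNReal.ofReal_add (by positivity) (by positivity),
          hofReal p hβ, hofReal p' hβ, ENNReal.ofReal_coe_nnreal] at this
        refine this.trans (mul_le_mul' le_rfl ?_)
        refine (add_le_add (enorm_rpow_le_one_add_rpow hβ hβθ p)
          (enorm_rpow_le_one_add_rpow hβ hβθ p')).trans (le_of_eq ?_)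
        ring
      exit_lsc := hΨ_lsc
      exit_mono := hΨ_mono
      exit_lower := hΨ_lower }
  exact ⟨hG.isStrongEquilibrium hgeo, MFG.IsStrongEquilibrium.isEquilibrium⟩
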